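/- Consider a discrete-time system $x^{+}=f(x,u)$ with $x\in\mathbb R^n$, $u\in\mathbb R^m$, $f$ smooth around an equilibrium $(x_0,u_0)$, $f(x_0,u_0)=x_0$, with $\operatorname{rank}\partial_u f=m$ and $\operatorname{rank}\partial_{(x,u)}f=n$ at $(x_0,u_0)$. Let $\zeta=g(x,u)$ be $m$ smooth functions such that $(x,u)\mapsto(x^+,\zeta)=(f(x,u),g(x,u))$ is a local diffeomorphism around $(x_0,u_0)$, with local inverse $(x,u)=(\psi_x(x^+,\zeta),\psi_u(x^+,\zeta))$. On the space with coordinates $(\dots,\zeta_{[-2]},\zeta_{[-1]},x,u,u_{[1]},u_{[2]},\dots)$ (product topology) the forward shift $\delta$ of functions is the substitution $\zeta_{[-k-1]}\mapsto\zeta_{[-k]}$ $(k\ge1)$, $\zeta_{[-1]}\mapsto g(x,u)$, $x\mapsto f(x,u)$, $u_{[k]}\mapsto u_{[k+1]}$ (with $u_{[0]}=u$), and the backward shift $\delta^{-1}$ is its inverse $\zeta_{[-k]}\mapsto\zeta_{[-k-1]}$, $x\mapsto\psi_x(x,\zeta_{[-1]})$, $u\mapsto\psi_u(x,\zeta_{[-1]})$,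 $u_{[k+1]}\mapsto u_{[k]}$; both are used locally around the equilibrium. Let the system be flat around $(x_0,u_0)$ with flat output $y=\varphi(\zeta_{[-Q_1,-1]},x,u,u_{[1,Q_2]})$, $y=(y^1,\dots,y^m)$, i.e. $\varphi$ is smooth around the equilibrium and there are multi-indices $R_1=(r_{1,1},\dots,r_{1,m})$, $R_2=(r_{2,1},\dots,r_{2,m})$ in $\mathbb N^m$ and smooth maps $F_x,F_u$ such that, with $y_{[k]}=\delta^k\varphi$, $$x=F_x(y_{[-R_1,R_2-1]}),\qquad u=F_u(y_{[-R_1,R_2]})$$ hold on a neighbourhood of the equilibrium; here $y_{[-R_1,R_2]}$ denotes the variables $y^j_{[k]}$ with $-r_{1,j}\le k\le r_{2,j}$, $1\le j\le m$, and $y_{[-R_1,R_2-1]}$ those with $-r_{1,j}\le k\le r_{2,j}-1$. Now regard $F_x$, $F_u$ and $g(F_x,F_u)$ as functions on the space with coordinates $(\dots,y_{[-1]},y,y_{[1]},\dots)$ (product topology), with shift $\delta:y_{[k]}\mapsto y_{[k+1]}$, near the point $\bar y$ all of whose coordinates $y_{[k]}$ are equal to the equilibrium value of $\varphi$. For multi-indices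 $M_1,M_2\in\mathbb N^m$ consider the condition that, at every point of some neighbourhood of $\bar y$, $$\operatorname{span}\{\mathrm dy_{[-R_1,R_2]}\}\subset\operatorname{span}\{\delta^{-M_1}\mathrm dg(F_x,F_u),\dots,\delta^{-1}\mathrm dg(F_x,F_u),\mathrm dF_x,\mathrm dF_u,\delta\,\mathrm dF_u,\dots,\delta^{M_2}\mathrm dF_u\},\qquad(\ast)$$ where on the right the forms are $\delta^{-k}\mathrm dg^j(F_x,F_u)$ with $1\le k\le M_{1,j}$, all $\mathrm dF_x^i$, and $\delta^{k}\mathrm dF_u^j$ with $0\le k\le M_{2,j}$. Then there is a least pair of multi-indices $(M_1,M_2)$ (for the componentwise order) for which $(\ast)$ holds, and for this pair: (i) the $m\times m$ block $\partial_{y_{[R_2]}}F_u=\bigl(\partial F_u^i/\partial y^j_{[r_{2,j}]}\bigr)_{i,j}$ has full rank $m$ on a neighbourhood of $\bar y$ if and only if $M_2=0$; (ii) the $n\times m$ block $\partial_{y_{[-R_1]}}F_x=\bigl(\partial F_x^i/\partial y^j_{[-r_{1,j}]}\bigr)_{i,j}$ has full rank $m$ on a neighbourhood of $\bar y$ if and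 only if $M_1=0$. -/

import Mathlib

open Filter Topology
open scoped ContDiff

namespace DTFlat

/-- A (locally defined) map is smooth on some neighbourhood of `p`; its values far from `p` are
irrelevant. -/
def SmoothNear {E G : Type*} [NormedAddCommGroup E] [NormedSpace ℝ E]
    [NormedAddCommGroup G] [NormedSpace ℝ G] (h : E → G) (p : E) : Prop :=
  ∀ᶠ q in 𝓝 p, ContDiffAt ℝ ∞ h q

/-! ### The system and its extension to a local diffeomorphism -/

/-- The discrete-time system `x⁺ = f(x,u)` with `n` states and `m` inputs, considered around the
equilibrium `(x₀,u₀)`: `f` is smooth, `rank ∂_u f = m` (independent inputs) and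
`rank ∂_(x,u) f = n` (submersivity). -/
structure IsSystem {n m : ℕ} (f : (Fin n → ℝ) × (Fin m → ℝ) → Fin n → ℝ)
    (x₀ : Fin n → ℝ) (u₀ : Fin m → ℝ) : Prop where
  equilibrium : f (x₀, u₀) = x₀
  smooth : SmoothNear f (x₀, u₀)
  independent_inputs :
    Module.finrank ℝ (LinearMap.range (fderiv ℝ (fun u => f (x₀, u)) u₀).toLinearMap) = m
  submersive :
    Module.finrank ℝ (LinearMap.range (fderiv ℝ f (x₀, u₀)).toLinearMap) = n

/-- The map `(x,u) ↦ (x⁺,ζ) = (f(x,u), g(x,u))` is a diffeomorphism from a neighbourhood of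
`(x₀,u₀)` onto a neighbourhood of its image `(x₀, g(x₀,u₀))`, with local inverse
`ψ = (ψ_x, ψ_u)`. -/
structure IsExtension {n m : ℕ} (f : (Fin n → ℝ) × (Fin m → ℝ) → Fin n → ℝ)
    (g : (Fin n → ℝ) × (Fin m → ℝ) → Fin m → ℝ)
    (ψ : (Fin n → ℝ) × (Fin m → ℝ) → (Fin n → ℝ) × (Fin m → ℝ))
    (x₀ : Fin n → ℝ) (u₀ : Fin m → ℝ) : Prop where
  smooth : SmoothNear g (x₀, u₀)
  smooth_inv : SmoothNear ψ (x₀, g (x₀, u₀))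
  left_inv : ∀ᶠ p in 𝓝 (x₀, u₀), ψ (f p, g p) = p
  right_inv : ∀ᶠ q in 𝓝 (x₀, g (x₀, u₀)), (f (ψ q), g (ψ q)) = q

/-! ### The space with coordinates `(…, ζ_[-2], ζ_[-1], x, u, u_[1], u_[2], …)` -/

/-- A point `P` of this space: `P.1 k = ζ_[-(k+1)]`, `P.2.1 = x` and `P.2.2 k = u_[k]`, where
`u_[0] = u`.  It carries the product topology, so a neighbourhood of a point constrains only
finitely many coordinates. -/
abbrev SysPoint (n m : ℕ) : Type :=
  (ℕ → Fin m → ℝ) × (Fin n → ℝ) × (ℕ → Fin m → ℝ)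

/-- The point given by the equilibrium trajectory. -/
def eqPoint {n m : ℕ} (g : (Fin n → ℝ) × (Fin m → ℝ) → Fin m → ℝ)
    (x₀ : Fin n → ℝ) (u₀ : Fin m → ℝ) : SysPoint n m :=
  (fun _ => g (x₀, u₀), x₀, fun _ => u₀)

/-- The forward shift on points; the forward-shift operator on functions is `δ h = h ∘ fwd`. -/
def fwd {n m : ℕ} (f : (Fin n → ℝ) × (Fin m → ℝ) → Fin n → ℝ)
    (g : (Fin n → ℝ) × (Fin m → ℝ) → Fin m → ℝ) (P : SysPoint n m) : SysPoint n m :=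
  (fun k => Nat.casesOn k (g (P.2.1, P.2.2 0)) P.1,
    f (P.2.1, P.2.2 0),
    fun k => P.2.2 (k + 1))

/-- The backward shift on points; the backward-shift operator on functions is
`δ⁻¹ h = h ∘ bwd`. -/
def bwd {n m : ℕ} (ψ : (Fin n → ℝ) × (Fin m → ℝ) → (Fin n → ℝ) × (Fin m → ℝ))
    (P : SysPoint n m) : SysPoint n m :=
  (fun k => P.1 (k + 1),
    (ψ (P.2.1, P.1 0)).1,
    fun k => Nat.casesOn k (ψ (P.2.1, P.1 0)).2 P.2.2)

/-- The shift by `k ∈ ℤ` on points, so that `δ^k h = h ∘ shiftSys k`. -/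
def shiftSys {n m : ℕ} (f : (Fin n → ℝ) × (Fin m → ℝ) → Fin n → ℝ)
    (g : (Fin n → ℝ) × (Fin m → ℝ) → Fin m → ℝ)
    (ψ : (Fin n → ℝ) × (Fin m → ℝ) → (Fin n → ℝ) × (Fin m → ℝ)) :
    ℤ → SysPoint n m → SysPoint n m
  | Int.ofNat k => (fwd f g)^[k]
  | Int.negSucc k => (bwd ψ)^[k + 1]

/-- The space of the arguments `(ζ_[-Q₁,-1], x, u, u_[1,Q₂])`, for multi-indices `Q₁`, `Q₂`. -/
abbrev OutArg (n : ℕ) {m : ℕ} (Q₁ Q₂ : Fin m → ℕ) : Type :=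
  ((Σ j : Fin m, Fin (Q₁ j)) → ℝ) × (Fin n → ℝ) × ((Σ j : Fin m, Fin (Q₂ j + 1)) → ℝ)

/-- The coordinates `(ζ_[-Q₁,-1], x, u, u_[1,Q₂])` of a point. -/
def outArg {n m : ℕ} (Q₁ Q₂ : Fin m → ℕ) (P : SysPoint n m) : OutArg n Q₁ Q₂ :=
  (fun w => P.1 w.2 w.1, P.2.1, fun w => P.2.2 w.2 w.1)

/-! ### The space with coordinates `(…, y_[-1], y, y_[1], …)` -/

/-- A point `Y` of this space, with `Y k j = y^j_[k]`; it carries the product topology. -/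
abbrev YPoint (m : ℕ) : Type := ℤ → Fin m → ℝ

/-- The shift by `k`, so that `δ^k h = h ∘ shiftY k`. -/
def shiftY {m : ℕ} (k : ℤ) (Y : YPoint m) : YPoint m := fun i => Y (i + k)

/-- Index set of the variables `y^j_[k]` with `a_j ≤ k ≤ b_j`. -/
abbrev Window {m : ℕ} (a b : Fin m → ℤ) : Type :=
  Σ j : Fin m, ↥(Finset.Icc (a j) (b j))

/-- The variables `y_[a,b]` of a point. -/
def window {m : ℕ} (a b : Fin m → ℤ) (Y : YPoint m) : Window a b → ℝ :=
  fun w => Y w.2 w.1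

/-- Lowest order `-R₁` of the shifts, as an integer multi-index. -/
def lo {m : ℕ} (R₁ : Fin m → ℕ) : Fin m → ℤ := fun j => -(R₁ j : ℤ)

/-- Highest order `R₂` of the shifts, as an integer multi-index. -/
def hi {m : ℕ} (R₂ : Fin m → ℕ) : Fin m → ℤ := fun j => (R₂ j : ℤ)

/-- The multi-index `R₂ - 1`, computed in the integers. -/
def hiPred {m : ℕ} (R₂ : Fin m → ℕ) : Fin m → ℤ := fun j => (R₂ j : ℤ) - 1

/-- The differential `dh` at the point `Y`, given by its coefficients: the `(k,j)` entry is the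
coefficient `∂h/∂y^j_[k]` of `dy^j_[k]`. -/
noncomputable def diffl {m : ℕ} (h : YPoint m → ℝ) (Y : YPoint m) : ℤ × Fin m → ℝ :=
  fun p => lineDeriv ℝ h Y (Pi.single p.1 (Pi.single p.2 1))

/-! ### Flat outputs -/

/-- The values `y^j_[k] = δ^k φ^j` at the point `P` of all shifts of the `m`-tuple of functions
`y^j = φ^j(ζ_[-Q₁,-1], x, u, u_[1,Q₂])`. -/
def outputs {n m : ℕ} (f : (Fin n → ℝ) × (Fin m → ℝ) → Fin n → ℝ)
    (g : (Fin n → ℝ) × (Fin m → ℝ) → Fin m → ℝ)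
    (ψ : (Fin n → ℝ) × (Fin m → ℝ) → (Fin n → ℝ) × (Fin m → ℝ))
    {Q₁ Q₂ : Fin m → ℕ} (φ : OutArg n Q₁ Q₂ → Fin m → ℝ) (P : SysPoint n m) : YPoint m :=
  fun k => φ (outArg Q₁ Q₂ (shiftSys f g ψ k P))

/-- The equilibrium point of the space of the `y`: every shift of `y` has the value `φ(ζ₀,x₀,u₀)`
of the flat output at the equilibrium. -/
def eqY {n m : ℕ} (g : (Fin n → ℝ) × (Fin m → ℝ) → Fin m → ℝ) (x₀ : Fin n → ℝ) (u₀ : Fin m → ℝ)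
    {Q₁ Q₂ : Fin m → ℕ} (φ : OutArg n Q₁ Q₂ → Fin m → ℝ) : YPoint m :=
  fun _ => φ (outArg Q₁ Q₂ (eqPoint g x₀ u₀))

/-- `y = φ(ζ_[-Q₁,-1], x, u, u_[1,Q₂])` is a flat output around the equilibrium `(x₀,u₀)`, with
parameterization `x = F_x(y_[-R₁,R₂-1])`, `u = F_u(y_[-R₁,R₂])`: all maps are smooth around the
equilibrium, and the two identities hold on a neighbourhood of the equilibrium. -/
structure IsFlatOutput {n m : ℕ} (f : (Fin n → ℝ) × (Fin m → ℝ) → Fin n → ℝ)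
    (g : (Fin n → ℝ) × (Fin m → ℝ) → Fin m → ℝ)
    (ψ : (Fin n → ℝ) × (Fin m → ℝ) → (Fin n → ℝ) × (Fin m → ℝ))
    (x₀ : Fin n → ℝ) (u₀ : Fin m → ℝ)
    {Q₁ Q₂ : Fin m → ℕ} (φ : OutArg n Q₁ Q₂ → Fin m → ℝ)
    {R₁ R₂ : Fin m → ℕ}
    (Fx : (Window (lo R₁) (hiPred R₂) → ℝ) → Fin n → ℝ)
    (Fu : (Window (lo R₁) (hi R₂) → ℝ) → Fin m → ℝ) : Prop where
  smooth_out : SmoothNear φ (outArg Q₁ Q₂ (eqPoint g x₀ u₀))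
  smooth_x : SmoothNear Fx (window (lo R₁) (hiPred R₂) (eqY g x₀ u₀ φ))
  smooth_u : SmoothNear Fu (window (lo R₁) (hi R₂) (eqY g x₀ u₀ φ))
  param_x : ∀ᶠ P in 𝓝 (eqPoint g x₀ u₀),
    P.2.1 = Fx (window (lo R₁) (hiPred R₂) (outputs f g ψ φ P))
  param_u : ∀ᶠ P in 𝓝 (eqPoint g x₀ u₀),
    P.2.2 0 = Fu (window (lo R₁) (hi R₂) (outputs f g ψ φ P))

/-! ### The parameterizing map on the space of the `y` and its Jacobian -/

/-- `F_x`, as a map on the space of the `y`. -/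
def stateMap {n m : ℕ} {R₁ R₂ : Fin m → ℕ}
    (Fx : (Window (lo R₁) (hiPred R₂) → ℝ) → Fin n → ℝ) (Y : YPoint m) : Fin n → ℝ :=
  Fx (window (lo R₁) (hiPred R₂) Y)

/-- `F_u`, as a map on the space of the `y`. -/
def inputMap {m : ℕ} {R₁ R₂ : Fin m → ℕ}
    (Fu : (Window (lo R₁) (hi R₂) → ℝ) → Fin m → ℝ) (Y : YPoint m) : Fin m → ℝ :=
  Fu (window (lo R₁) (hi R₂) Y)

/-- The block `∂F_u/∂y_[R₂]` of the Jacobian matrix at `Y`. -/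
noncomputable def topBlock {m : ℕ} {R₁ R₂ : Fin m → ℕ}
    (Fu : (Window (lo R₁) (hi R₂) → ℝ) → Fin m → ℝ) (Y : YPoint m) :
    Matrix (Fin m) (Fin m) ℝ :=
  Matrix.of fun i j => diffl (fun Z => inputMap Fu Z i) Y (hi R₂ j, j)

/-- The block `∂F_x/∂y_[-R₁]` of the Jacobian matrix at `Y`. -/
noncomputable def bottomBlock {n m : ℕ} {R₁ R₂ : Fin m → ℕ}
    (Fx : (Window (lo R₁) (hiPred R₂) → ℝ) → Fin n → ℝ) (Y : YPoint m) :
    Matrix (Fin n) (Fin m) ℝ :=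
  Matrix.of fun i j => diffl (fun Z => stateMap Fx Z i) Y (lo R₁ j, j)

/-! ### The span condition defining `M₁` and `M₂` -/

/-- `span {dy_[-R₁,R₂]}` at `Y`. -/
noncomputable def outputSpan {m : ℕ} (R₁ R₂ : Fin m → ℕ) (Y : YPoint m) :
    Submodule ℝ (ℤ × Fin m → ℝ) :=
  Submodule.span ℝ {η | ∃ (j : Fin m) (k : ℤ), lo R₁ j ≤ k ∧ k ≤ hi R₂ j ∧
    η = diffl (fun Z => Z k j) Y}

/-- `span {δ^(-M₁) dg(F_x,F_u), …, δ^(-1) dg(F_x,F_u), dF_x, dF_u, δ dF_u, …, δ^(M₂) dF_u}` at `Y`,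
for multi-indices `M₁`, `M₂`. -/
noncomputable def systemSpan {n m : ℕ} (g : (Fin n → ℝ) × (Fin m → ℝ) → Fin m → ℝ)
    {R₁ R₂ : Fin m → ℕ}
    (Fx : (Window (lo R₁) (hiPred R₂) → ℝ) → Fin n → ℝ)
    (Fu : (Window (lo R₁) (hi R₂) → ℝ) → Fin m → ℝ)
    (M₁ M₂ : Fin m → ℕ) (Y : YPoint m) : Submodule ℝ (ℤ × Fin m → ℝ) :=
  Submodule.span ℝ
    ({η | ∃ (j : Fin m) (k : ℕ), 1 ≤ k ∧ k ≤ M₁ j ∧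
        η = diffl (fun Z => g (stateMap Fx (shiftY (-(k : ℤ)) Z),
          inputMap Fu (shiftY (-(k : ℤ)) Z)) j) Y} ∪
     {η | ∃ i : Fin n, η = diffl (fun Z => stateMap Fx Z i) Y} ∪
     {η | ∃ (j : Fin m) (k : ℕ), k ≤ M₂ j ∧
        η = diffl (fun Z => inputMap Fu (shiftY (k : ℤ) Z) j) Y})

/-- The pairs of multi-indices `(M₁,M₂)` for which the span condition
`span {dy_[-R₁,R₂]} ⊆ span {δ^(-M₁) dg(F_x,F_u), …, dF_x, dF_u, …, δ^(M₂) dF_u}` holds on a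
neighbourhood of the point `Y₀`. -/
def spanOrders {n m : ℕ} (g : (Fin n → ℝ) × (Fin m → ℝ) → Fin m → ℝ)
    {R₁ R₂ : Fin m → ℕ}
    (Fx : (Window (lo R₁) (hiPred R₂) → ℝ) → Fin n → ℝ)
    (Fu : (Window (lo R₁) (hi R₂) → ℝ) → Fin m → ℝ)
    (Y₀ : YPoint m) : Set ((Fin m → ℕ) × (Fin m → ℕ)) :=
  {M | ∀ᶠ Y in 𝓝 Y₀, outputSpan R₁ R₂ Y ≤ systemSpan g Fx Fu M.1 M.2 Y}

end DTFlat

/-! Near the equilibrium, the coordinates (ζ_[-k], x, u_[k]) and the coordinates y_[k] are two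
charts of the same object: `outputs` and `sysOfY` invert each other, as far as any finite set of
coordinates can see. The real content is that the outputs and all their shifts are independent, so
that identities known along trajectories become identities on a full neighbourhood of the point
`eqY`. For this, forms on the system space are regarded as a module over ℝ[X], with X acting as the
shift. The m forms du^j are independent over ℝ[X] and, by flatness, lie in the span of the m forms
dy^j_[-N] for large N; over a commutative ring this forces the dy^j_[-N] to be independent as well
(`linearIndependent_of_mem_span`, `linearIndependent_outForm`). Hence `outputs` is a submersion onto
every finite window of the y, and the inverse function theorem gives the transfer principle
`eventually_of_outputs`.

Two consequences yield the least pair. The generators on the right of the span condition are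
independent (`linearIndepOn_sysForm`), so spans intersect along their index sets and the admissible
pairs are closed under infimum. Each dy^j_[k] is a combination of finitely many generators
(`diffl_coord_mem_span`), so admissible pairs exist; well-foundedness finishes.

For (i), the coefficients of δ^K dF_u at the order R₂+K form the top block at a shifted point, and
no generator of lower K reaches that order. If the block is regular, block-triangular elimination
(`mem_of_triangular`) removes all forms with K ≥ 1. If M₂ = 0, a kernel vector v of the block gives
the tangent vector ∑ v_j ∂/∂y^j_[r_{2,j}], which annihilates every generator and therefore every dy,
so v = 0. Part (ii) mirrors this at the order -R₁-K with g(F_x,F_u) in place of F_u. The passage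
between F_x and g(F_x,F_u) comes from differentiating δF_x = f(F_x,F_u) along the lowest variables
y_[-R₁], on which the left side does not depend (`eventually_lowest_relations`). -/

namespace DTFlat

open Asymptotics

/-! ### Strict differentiability between topological vector spaces -/

section Calculus

variable {E F G : Type*} [AddCommGroup E] [Module ℝ E] [TopologicalSpace E]
  [AddCommGroup F] [Module ℝ F] [TopologicalSpace F]
  [AddCommGroup G] [Module ℝ G] [TopologicalSpace G]

/-- Infinite products of coordinates carry no suitable norm, so derivatives are taken between
topological vector spaces. Strict derivatives are used because they compose and, on
finite-dimensional slices, feed the inverse function theorem. -/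
theorem strict_comp [ContinuousAdd E] [ContinuousSMul ℝ E] [ContinuousAdd F] [ContinuousSMul ℝ F]
    [ContinuousAdd G] [ContinuousSMul ℝ G]
    {f : E → F} {f' : E →L[ℝ] F} {g : F → G} {g' : F →L[ℝ] G} {x : E}
    (hg : HasStrictFDerivAt g g' (f x)) (hf : HasStrictFDerivAt f f' x) :
    HasStrictFDerivAt (fun y => g (f y)) (g'.comp f') x := by
  have hL : Tendsto (Prod.map f f) (𝓝 (x, x)) (𝓝 (f x, f x)) :=
    hf.continuousAt.tendsto.prodMap_nhds hf.continuousAt.tendsto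
  refine .of_isLittleOTVS <| calc
    (fun p : E × E ↦ g (f p.1) - g (f p.2) - (g'.comp f') (p.1 - p.2))
      = fun p ↦ (g (f p.1) - g (f p.2) - g' (f p.1 - f p.2)) +
          g' (f p.1 - f p.2 - f' (p.1 - p.2)) := by
      ext; simp
    _ =o[ℝ; 𝓝 (x, x)] (fun p ↦ p.1 - p.2) := .add ?Hg ?Hf
  case Hg => calc (fun p : E × E ↦ g (f p.1) - g (f p.2) - g' (f p.1 - f p.2))
    _ =o[ℝ; 𝓝 (x, x)] (fun p ↦ f p.1 - f p.2) :=
      hg.isLittleOTVS.comp_tendsto hL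
    _ =O[ℝ; 𝓝 (x, x)] (fun p ↦ p.1 - p.2) := hf.isBigOTVS_sub
  case Hf => calc (fun p : E × E ↦ g' (f p.1 - f p.2 - f' (p.1 - p.2)))
    _ =O[ℝ; 𝓝 (x, x)] (fun p ↦ f p.1 - f p.2 - f' (p.1 - p.2)) := g'.isBigOTVS_comp
    _ =o[ℝ; 𝓝 (x, x)] (fun p ↦ p.1 - p.2) := hf.isLittleOTVS

theorem strict_clm (L : E →L[ℝ] F) (x : E) : HasStrictFDerivAt L L x :=
  .of_isLittleOTVS <| (IsLittleOTVS.zero _ _).congr_left <| by simp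

theorem strict_const (c : F) (x : E) : HasStrictFDerivAt (fun _ : E => c) (0 : E →L[ℝ] F) x :=
  .of_isLittleOTVS <| (IsLittleOTVS.zero _ _).congr_left <| by simp

theorem strict_prodMk [ContinuousSMul ℝ F] [ContinuousSMul ℝ G] {f : E → F} {f' : E →L[ℝ] F}
    {g : E → G} {g' : E →L[ℝ] G} {x : E}
    (hf : HasStrictFDerivAt f f' x) (hg : HasStrictFDerivAt g g' x) :
    HasStrictFDerivAt (fun y => (f y, g y)) (f'.prod g') x :=
  .of_isLittleOTVS <| hf.isLittleOTVS.prodMk hg.isLittleOTVS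

theorem strict_pi {ι : Type*} {F : ι → Type*} [∀ i, AddCommGroup (F i)] [∀ i, Module ℝ (F i)]
    [∀ i, TopologicalSpace (F i)] [∀ i, ContinuousSMul ℝ (F i)]
    {f : E → ∀ i, F i} {f' : ∀ i, E →L[ℝ] F i} {x : E}
    (hf : ∀ i, HasStrictFDerivAt (fun y => f y i) (f' i) x) :
    HasStrictFDerivAt f (ContinuousLinearMap.pi f') x :=
  .of_isLittleOTVS <| IsLittleOTVS.pi fun i => (hf i).isLittleOTVS

theorem strict_congr {f g : E → F} {f' : E →L[ℝ] F} {x : E} (h : HasStrictFDerivAt f f' x)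
    (hfg : f =ᶠ[𝓝 x] g) : HasStrictFDerivAt g f' x := by
  refine .of_isLittleOTVS (h.isLittleOTVS.congr' ?_ (EventuallyEq.refl _ _))
  rw [nhds_prod_eq]
  filter_upwards [hfg.prodMap hfg] with p hp
  have hp : f p.1 = g p.1 ∧ f p.2 = g p.2 := Prod.ext_iff.1 hp
  rw [hp.1, hp.2]

/-- `h` has some strict derivative at `x`. -/
def StrictDiffAt (h : E → F) (x : E) : Prop := ∃ L : E →L[ℝ] F, HasStrictFDerivAt h L x

theorem strict_unique [ContinuousAdd E] [ContinuousSMul ℝ E] [ContinuousAdd F]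
    [ContinuousSMul ℝ F] [T2Space F]
    {f : E → F} {f₁ f₂ : E →L[ℝ] F} {x : E} (h₁ : HasStrictFDerivAt f f₁ x)
    (h₂ : HasStrictFDerivAt f f₂ x) : f₁ = f₂ :=
  h₁.hasFDerivAt.unique h₂.hasFDerivAt

/-- Bridge between `diffl`, which is defined by line derivatives, and the chain rule for strict
derivatives. -/
theorem lineDeriv_eq_of_strict {F : Type*} [NormedAddCommGroup F] [NormedSpace ℝ F]
    [ContinuousAdd E] [ContinuousSMul ℝ E]
    {h : E → F} {L : E →L[ℝ] F} {x : E} (hL : HasStrictFDerivAt h L x) (v : E) :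
    lineDeriv ℝ h x v = L v := by
  have h1 : HasStrictFDerivAt (fun t : ℝ => x + t • v)
      (ContinuousLinearMap.toSpanSingleton ℝ v) 0 :=
    .of_isLittleOTVS <| (IsLittleOTVS.zero _ _).congr_left <| by
      intro p; simp [ContinuousLinearMap.toSpanSingleton_apply, sub_smul]
  have h2 : HasStrictFDerivAt h L ((fun t : ℝ => x + t • v) 0) := by simpa using hL
  have h3 := (strict_comp (f := fun t : ℝ => x + t • v) h2 h1).hasFDerivAt.hasDerivAt.deriv
  rw [lineDeriv, h3]
  simp

end Calculus

theorem lineDeriv_congr_of_eq {E F : Type*} [AddCommGroup E] [Module ℝ E] [NormedAddCommGroup F] [NormedSpace ℝ F]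
    {h : E → F} {x v : E} (hv : ∀ t : ℝ, h (x + t • v) = h x) : lineDeriv ℝ h x v = 0 := by
  rw [lineDeriv, funext hv]; simp

theorem SmoothNear.eventually_strict {E G : Type*} [NormedAddCommGroup E] [NormedSpace ℝ E]
    [NormedAddCommGroup G] [NormedSpace ℝ G] {h : E → G} {p : E} (hs : SmoothNear h p) :
    ∀ᶠ q in 𝓝 p, HasStrictFDerivAt h (fderiv ℝ h q) q :=
  hs.mono fun _ hq => hq.hasStrictFDerivAt (by simp)

section StrictDiffAt

variable {E F G : Type*} [AddCommGroup E] [Module ℝ E] [TopologicalSpace E]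
  [AddCommGroup F] [Module ℝ F] [TopologicalSpace F]
  [AddCommGroup G] [Module ℝ G] [TopologicalSpace G]

theorem StrictDiffAt.comp [ContinuousAdd E] [ContinuousSMul ℝ E] [ContinuousAdd F]
    [ContinuousSMul ℝ F] [ContinuousAdd G] [ContinuousSMul ℝ G]
    {f : E → F} {g : F → G} {x : E}
    (hg : StrictDiffAt g (f x)) (hf : StrictDiffAt f x) : StrictDiffAt (fun y => g (f y)) x :=
  ⟨_, strict_comp hg.choose_spec hf.choose_spec⟩

theorem StrictDiffAt.prodMk [ContinuousSMul ℝ F] [ContinuousSMul ℝ G] {f : E → F} {g : E → G}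
    {x : E} (hf : StrictDiffAt f x) (hg : StrictDiffAt g x) :
    StrictDiffAt (fun y => (f y, g y)) x :=
  ⟨_, strict_prodMk hf.choose_spec hg.choose_spec⟩

theorem StrictDiffAt.pi {ι : Type*} {F : ι → Type*} [∀ i, AddCommGroup (F i)]
    [∀ i, Module ℝ (F i)] [∀ i, TopologicalSpace (F i)] [∀ i, ContinuousSMul ℝ (F i)]
    {f : E → ∀ i, F i} {x : E} (hf : ∀ i, StrictDiffAt (fun y => f y i) x) : StrictDiffAt f x :=
  ⟨_, strict_pi fun i => (hf i).choose_spec⟩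

theorem StrictDiffAt.clm (L : E →L[ℝ] F) (x : E) : StrictDiffAt L x := ⟨L, strict_clm L x⟩

theorem StrictDiffAt.const (c : F) (x : E) : StrictDiffAt (fun _ : E => c) x :=
  ⟨0, strict_const c x⟩

theorem StrictDiffAt.continuousAt [ContinuousAdd E] [ContinuousSMul ℝ E] [ContinuousAdd F]
    [ContinuousSMul ℝ F] {f : E → F} {x : E} (h : StrictDiffAt f x) : ContinuousAt f x :=
  h.choose_spec.continuousAt

end StrictDiffAt

theorem SmoothNear.strictDiffAt {E G : Type*} [NormedAddCommGroup E] [NormedSpace ℝ E]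
    [NormedAddCommGroup G] [NormedSpace ℝ G] {h : E → G} {p : E} (hs : SmoothNear h p) :
    ∀ᶠ q in 𝓝 p, StrictDiffAt h q :=
  hs.eventually_strict.mono fun _ hq => ⟨_, hq⟩

/-! ### Coordinates on the system space -/

section Coordinates

variable (n m : ℕ)

/-- The coordinates `(x, u)`. -/
def xuCoord : SysPoint n m →L[ℝ] (Fin n → ℝ) × (Fin m → ℝ) :=
  ((ContinuousLinearMap.fst ℝ _ _).comp (ContinuousLinearMap.snd ℝ _ _)).prod
    ((ContinuousLinearMap.proj 0).comp
      ((ContinuousLinearMap.snd ℝ _ _).comp (ContinuousLinearMap.snd ℝ _ _)))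

/-- The coordinate `x`. -/
def xCoord : SysPoint n m →L[ℝ] (Fin n → ℝ) :=
  (ContinuousLinearMap.fst ℝ _ _).comp (ContinuousLinearMap.snd ℝ _ _)

/-- The coordinate `ζ_[-(k+1)]`. -/
def zCoord (k : ℕ) : SysPoint n m →L[ℝ] (Fin m → ℝ) :=
  (ContinuousLinearMap.proj k).comp (ContinuousLinearMap.fst ℝ _ _)

/-- The coordinate `u_[k]`. -/
def uCoord (k : ℕ) : SysPoint n m →L[ℝ] (Fin m → ℝ) :=
  (ContinuousLinearMap.proj k).comp
    ((ContinuousLinearMap.snd ℝ _ _).comp (ContinuousLinearMap.snd ℝ _ _))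

end Coordinates

/-! ### The shifts on the system space -/

section Shifts

variable {n m : ℕ} {f : (Fin n → ℝ) × (Fin m → ℝ) → Fin n → ℝ}
  {g : (Fin n → ℝ) × (Fin m → ℝ) → Fin m → ℝ}
  {ψ : (Fin n → ℝ) × (Fin m → ℝ) → (Fin n → ℝ) × (Fin m → ℝ)}
  {x₀ : Fin n → ℝ} {u₀ : Fin m → ℝ}

theorem fwd_eqPoint (hf : IsSystem f x₀ u₀) : fwd f g (eqPoint g x₀ u₀) = eqPoint g x₀ u₀ := by
  refine Prod.ext (funext fun k => ?_) (Prod.ext hf.equilibrium rfl)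
  cases k <;> rfl

theorem psi_eq (hf : IsSystem f x₀ u₀) (hg : IsExtension f g ψ x₀ u₀) :
    ψ (x₀, g (x₀, u₀)) = (x₀, u₀) := by
  simpa [hf.equilibrium] using hg.left_inv.self_of_nhds

theorem bwd_eqPoint (hf : IsSystem f x₀ u₀) (hg : IsExtension f g ψ x₀ u₀) :
    bwd ψ (eqPoint g x₀ u₀) = eqPoint g x₀ u₀ := by
  have h := psi_eq hf hg
  refine Prod.ext rfl (Prod.ext ?_ (funext fun k => ?_))
  · simp [bwd, eqPoint, h]
  · cases k <;> simp [bwd, eqPoint, h]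

theorem eventually_xu {p : (Fin n → ℝ) × (Fin m → ℝ) → Prop} (h : ∀ᶠ q in 𝓝 (x₀, u₀), p q) :
    ∀ᶠ P in 𝓝 (eqPoint g x₀ u₀), p (P.2.1, P.2.2 0) :=
  ((xuCoord n m).continuous.tendsto (eqPoint g x₀ u₀)).eventually h

theorem eventually_xz {p : (Fin n → ℝ) × (Fin m → ℝ) → Prop}
    (h : ∀ᶠ q in 𝓝 (x₀, g (x₀, u₀)), p q) :
    ∀ᶠ P in 𝓝 (eqPoint g x₀ u₀), p (P.2.1, P.1 0) :=
  (((xCoord n m).prod (zCoord n m 0)).continuous.tendsto (eqPoint g x₀ u₀)).eventually h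

theorem strictDiffAt_fwd (hf : IsSystem f x₀ u₀) (hg : IsExtension f g ψ x₀ u₀) :
    ∀ᶠ P in 𝓝 (eqPoint g x₀ u₀), StrictDiffAt (fwd f g) P := by
  filter_upwards [eventually_xu hf.smooth.strictDiffAt, eventually_xu hg.smooth.strictDiffAt]
    with P hfP hgP
  refine StrictDiffAt.prodMk (StrictDiffAt.pi fun k => ?_) (StrictDiffAt.prodMk ?_ ?_)
  · cases k with
    | zero => exact StrictDiffAt.comp (f := xuCoord n m) hgP (.clm _ P)
    | succ k => exact .clm (zCoord n m k) P
  · exact StrictDiffAt.comp (f := xuCoord n m) hfP (.clm _ P)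
  · exact StrictDiffAt.pi fun k => .clm (uCoord n m (k + 1)) P

theorem strictDiffAt_bwd (hg : IsExtension f g ψ x₀ u₀) :
    ∀ᶠ P in 𝓝 (eqPoint g x₀ u₀), StrictDiffAt (bwd ψ) P := by
  filter_upwards [eventually_xz hg.smooth_inv.strictDiffAt] with P hP
  have hψ : StrictDiffAt (fun P : SysPoint n m => ψ (P.2.1, P.1 0)) P :=
    StrictDiffAt.comp (f := (xCoord n m).prod (zCoord n m 0)) hP (.clm _ P)
  refine StrictDiffAt.prodMk (StrictDiffAt.pi fun k => .clm (zCoord n m (k + 1)) P)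
    (StrictDiffAt.prodMk ?_ (StrictDiffAt.pi fun k => ?_))
  · exact StrictDiffAt.comp (.clm (ContinuousLinearMap.fst ℝ (Fin n → ℝ) (Fin m → ℝ)) _) hψ
  · cases k with
    | zero => exact StrictDiffAt.comp (.clm (ContinuousLinearMap.snd ℝ (Fin n → ℝ) (Fin m → ℝ)) _) hψ
    | succ k => exact .clm (uCoord n m k) P

theorem fwd_bwd (hg : IsExtension f g ψ x₀ u₀) :
    ∀ᶠ P in 𝓝 (eqPoint g x₀ u₀), fwd f g (bwd ψ P) = P := by
  filter_upwards [eventually_xz hg.right_inv] with P hP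
  obtain ⟨h1, h2⟩ := Prod.ext_iff.1 hP
  refine Prod.ext (funext fun k => ?_) (Prod.ext h1 rfl)
  cases k with
  | zero => exact h2
  | succ k => rfl

theorem bwd_fwd (hg : IsExtension f g ψ x₀ u₀) :
    ∀ᶠ P in 𝓝 (eqPoint g x₀ u₀), bwd ψ (fwd f g P) = P := by
  filter_upwards [eventually_xu hg.left_inv] with P hP
  obtain ⟨h1, h2⟩ := Prod.ext_iff.1 hP
  refine Prod.ext rfl (Prod.ext h1 (funext fun k => ?_))
  cases k with
  | zero => exact h2
  | succ k => rfl

theorem tendsto_fwd (hf : IsSystem f x₀ u₀) (hg : IsExtension f g ψ x₀ u₀) :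
    Tendsto (fwd f g) (𝓝 (eqPoint g x₀ u₀)) (𝓝 (eqPoint g x₀ u₀)) := by
  have := (strictDiffAt_fwd hf hg).self_of_nhds.continuousAt
  rwa [ContinuousAt, fwd_eqPoint hf] at this

theorem tendsto_bwd (hf : IsSystem f x₀ u₀) (hg : IsExtension f g ψ x₀ u₀) :
    Tendsto (bwd ψ) (𝓝 (eqPoint g x₀ u₀)) (𝓝 (eqPoint g x₀ u₀)) := by
  have := (strictDiffAt_bwd hg).self_of_nhds.continuousAt
  rwa [ContinuousAt, bwd_eqPoint hf hg] at this

theorem shiftSys_ofNat (k : ℕ) : shiftSys f g ψ (k : ℤ) = (fwd f g)^[k] := rfl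

theorem shiftSys_negSucc (k : ℕ) : shiftSys f g ψ (Int.negSucc k) = (bwd ψ)^[k + 1] := rfl

theorem shiftSys_zero : shiftSys f g ψ 0 = id := rfl

theorem shiftSys_add_one (hf : IsSystem f x₀ u₀) (hg : IsExtension f g ψ x₀ u₀) (k : ℤ) :
    ∀ᶠ P in 𝓝 (eqPoint g x₀ u₀),
      shiftSys f g ψ (k + 1) P = fwd f g (shiftSys f g ψ k P) := by
  cases k with
  | ofNat k =>
    refine .of_forall fun P => ?_
    have : shiftSys f g ψ (Int.ofNat k + 1) = (fwd f g)^[k + 1] := rfl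
    rw [this, Function.iterate_succ_apply']
    rfl
  | negSucc k =>
    have ht : Tendsto ((bwd ψ)^[k]) (𝓝 (eqPoint g x₀ u₀)) (𝓝 (eqPoint g x₀ u₀)) :=
      (tendsto_bwd hf hg).iterate k
    filter_upwards [ht.eventually (fwd_bwd hg)] with P hP
    rw [shiftSys_negSucc, Function.iterate_succ_apply', hP]
    cases k with
    | zero => rfl
    | succ k =>
      have : Int.negSucc (k + 1) + 1 = Int.negSucc k := by omega
      rw [this, shiftSys_negSucc]

theorem tendsto_shiftSys (hf : IsSystem f x₀ u₀) (hg : IsExtension f g ψ x₀ u₀) (k : ℤ) :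
    Tendsto (shiftSys f g ψ k) (𝓝 (eqPoint g x₀ u₀)) (𝓝 (eqPoint g x₀ u₀)) := by
  cases k with
  | ofNat k => exact (tendsto_fwd hf hg).iterate k
  | negSucc k => exact (tendsto_bwd hf hg).iterate (k + 1)

theorem shiftSys_sub_one (hf : IsSystem f x₀ u₀) (hg : IsExtension f g ψ x₀ u₀) (k : ℤ) :
    ∀ᶠ P in 𝓝 (eqPoint g x₀ u₀),
      shiftSys f g ψ (k - 1) P = bwd ψ (shiftSys f g ψ k P) := by
  filter_upwards [shiftSys_add_one hf hg (k - 1),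
    (tendsto_shiftSys hf hg (k - 1)).eventually (bwd_fwd hg)] with P h1 h2
  rw [← h2, ← h1, sub_add_cancel]

/-- The two shifts are mutually inverse only locally, so the group law holds on a neighbourhood that
depends on `a` and `b`. -/
theorem shiftSys_add (hf : IsSystem f x₀ u₀) (hg : IsExtension f g ψ x₀ u₀) (a b : ℤ) :
    ∀ᶠ P in 𝓝 (eqPoint g x₀ u₀),
      shiftSys f g ψ (a + b) P = shiftSys f g ψ a (shiftSys f g ψ b P) := by
  induction a using Int.induction_on with
  | zero => simp [shiftSys_zero]
  | succ i ih =>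
    filter_upwards [ih, shiftSys_add_one hf hg (i + b),
      (tendsto_shiftSys hf hg b).eventually (shiftSys_add_one hf hg i)] with P h1 h2 h3
    rw [h3, ← h1, ← h2]
    congr 1; ring
  | pred i ih =>
    filter_upwards [ih, shiftSys_sub_one hf hg (-i + b),
      (tendsto_shiftSys hf hg b).eventually (shiftSys_sub_one hf hg (-i))] with P h1 h2 h3
    rw [h3, ← h1, ← h2]
    congr 1; ring

theorem shiftSys_eqPoint (hf : IsSystem f x₀ u₀) (hg : IsExtension f g ψ x₀ u₀) (k : ℤ) :
    shiftSys f g ψ k (eqPoint g x₀ u₀) = eqPoint g x₀ u₀ := by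
  cases k with
  | ofNat k => exact Function.iterate_fixed (fwd_eqPoint hf) k
  | negSucc k => exact Function.iterate_fixed (bwd_eqPoint hf hg) (k + 1)

theorem strictDiffAt_iterate {E : Type*} [AddCommGroup E] [Module ℝ E] [TopologicalSpace E]
    [ContinuousAdd E] [ContinuousSMul ℝ E] {F : E → E} {p : E}
    (h : ∀ᶠ q in 𝓝 p, StrictDiffAt F q) (hF : Tendsto F (𝓝 p) (𝓝 p)) (k : ℕ) :
    ∀ᶠ q in 𝓝 p, StrictDiffAt F^[k] q := by
  induction k with
  | zero => exact .of_forall fun q => .clm (.id ℝ E) q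
  | succ k ih =>
    filter_upwards [h, hF.eventually ih] with q h1 h2
    exact StrictDiffAt.comp (g := F^[k]) h2 h1

theorem strictDiffAt_shiftSys (hf : IsSystem f x₀ u₀) (hg : IsExtension f g ψ x₀ u₀) (k : ℤ) :
    ∀ᶠ P in 𝓝 (eqPoint g x₀ u₀), StrictDiffAt (shiftSys f g ψ k) P := by
  cases k with
  | ofNat k => exact strictDiffAt_iterate (strictDiffAt_fwd hf hg) (tendsto_fwd hf hg) k
  | negSucc k => exact strictDiffAt_iterate (strictDiffAt_bwd hg) (tendsto_bwd hf hg) (k + 1)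

/-- The points `P` and `P'` have the same coordinates `ζ_[-(k+1)]`, `u_[k]`, `k < N`, and `x`. -/
def Agree (N : ℕ) (P P' : SysPoint n m) : Prop :=
  (∀ k < N, P.1 k = P'.1 k) ∧ P.2.1 = P'.2.1 ∧ ∀ k < N, P.2.2 k = P'.2.2 k

/-- The spare order pays for u_[k+1] becoming u_[k]; it also makes u_[0], on which f and g depend,
available when `N = 0`. -/
theorem Agree.fwd {N : ℕ} {P P' : SysPoint n m} (h : Agree (N + 1) P P') :
    Agree N (fwd f g P) (fwd f g P') := by
  obtain ⟨h1, h2, h3⟩ := h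
  refine ⟨fun k hk => ?_, ?_, fun k hk => h3 _ (by omega)⟩
  · cases k with
    | zero => simp [DTFlat.fwd, h2, h3 0 (by omega)]
    | succ k => exact h1 k (by omega)
  · simp only [DTFlat.fwd, h2, h3 0 (by omega)]

theorem Agree.bwd {N : ℕ} {P P' : SysPoint n m} (h : Agree (N + 1) P P') :
    Agree N (bwd ψ P) (bwd ψ P') := by
  obtain ⟨h1, h2, h3⟩ := h
  refine ⟨fun k hk => h1 _ (by omega), ?_, fun k hk => ?_⟩
  · simp only [DTFlat.bwd, h2, h1 0 (by omega)]
  · cases k with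
    | zero => simp [DTFlat.bwd, h2, h1 0 (by omega)]
    | succ k => exact h3 k (by omega)

theorem Agree.shiftSys {N : ℕ} {P P' : SysPoint n m} {k : ℤ} (h : Agree (N + k.natAbs) P P') :
    Agree N (shiftSys f g ψ k P) (shiftSys f g ψ k P') := by
  have key : ∀ (F : SysPoint n m → SysPoint n m)
      (_ : ∀ N P P', Agree (N + 1) P P' → Agree N (F P) (F P')) (j N : ℕ) (P P' : SysPoint n m),
      Agree (N + j) P P' → Agree N (F^[j] P) (F^[j] P') := by
    intro F hF j
    induction j with
    | zero => exact fun N P P' h => h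
    | succ j ih => exact fun N P P' h => ih N _ _ (hF _ _ _ h)
  cases k with
  | ofNat k => exact key _ (fun _ _ _ h => h.fwd) k N P P' h
  | negSucc k => exact key _ (fun _ _ _ h => h.bwd) (k + 1) N P P' h

theorem iterate_fwd_u (k : ℕ) (P : SysPoint n m) (i : ℕ) :
    ((fwd f g)^[k] P).2.2 i = P.2.2 (i + k) := by
  induction k generalizing P with
  | zero => rfl
  | succ k ih =>
    rw [Function.iterate_succ_apply, ih]
    change P.2.2 (i + k + 1) = _
    rw [add_assoc]

/-- The value of g produced by the first forward step is pushed back one place by each of the `k`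
remaining steps. -/
theorem iterate_fwd_z (k : ℕ) (P : SysPoint n m) :
    ((fwd f g)^[k + 1] P).1 k = g (P.2.1, P.2.2 0) := by
  have h : ∀ j (P : SysPoint n m) i, ((fwd f g)^[j] P).1 (i + j) = P.1 i := by
    intro j
    induction j with
    | zero => exact fun _ _ => rfl
    | succ j ih =>
      intro P i
      rw [Function.iterate_succ_apply, show i + (j + 1) = (i + 1) + j by ring, ih]
      rfl
  rw [Function.iterate_succ_apply]
  have := h k (fwd f g P) 0
  rwa [zero_add] at this

end Shifts

/-! ### The outputs as functions on the system space -/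

section Outputs

variable {n m : ℕ} {f : (Fin n → ℝ) × (Fin m → ℝ) → Fin n → ℝ}
  {g : (Fin n → ℝ) × (Fin m → ℝ) → Fin m → ℝ}
  {ψ : (Fin n → ℝ) × (Fin m → ℝ) → (Fin n → ℝ) × (Fin m → ℝ)}
  {x₀ : Fin n → ℝ} {u₀ : Fin m → ℝ}
  {Q₁ Q₂ R₁ R₂ : Fin m → ℕ} {φ : OutArg n Q₁ Q₂ → Fin m → ℝ}
  {Fx : (Window (lo R₁) (hiPred R₂) → ℝ) → Fin n → ℝ}
  {Fu : (Window (lo R₁) (hi R₂) → ℝ) → Fin m → ℝ}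

/-- The coordinates `(ζ_[-Q₁,-1], x, u, u_[1,Q₂])`, as a continuous linear map. -/
def outArgCLM (n : ℕ) {m : ℕ} (Q₁ Q₂ : Fin m → ℕ) : SysPoint n m →L[ℝ] OutArg n Q₁ Q₂ :=
  (ContinuousLinearMap.pi fun w => (ContinuousLinearMap.proj w.1).comp (zCoord n m w.2)).prod
    ((xCoord n m).prod
      (ContinuousLinearMap.pi fun w => (ContinuousLinearMap.proj w.1).comp (uCoord n m w.2)))

theorem strictDiffAt_outputs (hf : IsSystem f x₀ u₀) (hg : IsExtension f g ψ x₀ u₀)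
    (hφ : SmoothNear φ (outArg Q₁ Q₂ (eqPoint g x₀ u₀))) (k : ℤ) :
    ∀ᶠ P in 𝓝 (eqPoint g x₀ u₀), StrictDiffAt (fun P => outputs f g ψ φ P k) P := by
  have h1 : ∀ᶠ P in 𝓝 (eqPoint g x₀ u₀), StrictDiffAt φ (outArg Q₁ Q₂ P) :=
    ((outArgCLM n Q₁ Q₂).continuous.tendsto (eqPoint g x₀ u₀)).eventually hφ.strictDiffAt
  filter_upwards [(tendsto_shiftSys hf hg k).eventually h1, strictDiffAt_shiftSys hf hg k]
    with P hP1 hP2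
  exact StrictDiffAt.comp (f := fun P => outArg Q₁ Q₂ (shiftSys f g ψ k P)) hP1
    (StrictDiffAt.comp (.clm (outArgCLM n Q₁ Q₂) _) hP2)

theorem outputs_eqPoint (hf : IsSystem f x₀ u₀) (hg : IsExtension f g ψ x₀ u₀) :
    outputs f g ψ φ (eqPoint g x₀ u₀) = eqY g x₀ u₀ φ := by
  funext k
  simp only [outputs, eqY, shiftSys_eqPoint hf hg]

/-- Joint differentiability of all outputs is claimed at the equilibrium only: elsewhere the
neighbourhoods depend on `k`, and an infinite intersection of them need not be a neighbourhood. -/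
theorem strictDiffAt_outputs_eqPoint (hf : IsSystem f x₀ u₀) (hg : IsExtension f g ψ x₀ u₀)
    (hφ : SmoothNear φ (outArg Q₁ Q₂ (eqPoint g x₀ u₀))) :
    StrictDiffAt (outputs f g ψ φ) (eqPoint g x₀ u₀) :=
  StrictDiffAt.pi fun k => (strictDiffAt_outputs hf hg hφ k).self_of_nhds

theorem tendsto_outputs (hf : IsSystem f x₀ u₀) (hg : IsExtension f g ψ x₀ u₀)
    (hφ : SmoothNear φ (outArg Q₁ Q₂ (eqPoint g x₀ u₀))) :
    Tendsto (outputs f g ψ φ) (𝓝 (eqPoint g x₀ u₀)) (𝓝 (eqY g x₀ u₀ φ)) := by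
  have := (strictDiffAt_outputs_eqPoint hf hg hφ).continuousAt
  rwa [ContinuousAt, outputs_eqPoint hf hg] at this

theorem outputs_shiftSys (hf : IsSystem f x₀ u₀) (hg : IsExtension f g ψ x₀ u₀) (a k : ℤ) :
    ∀ᶠ P in 𝓝 (eqPoint g x₀ u₀),
      outputs f g ψ φ (shiftSys f g ψ a P) k = outputs f g ψ φ P (k + a) := by
  filter_upwards [shiftSys_add hf hg k a] with P hP
  simp only [outputs, hP]

/-- Each output depends on finitely many coordinates. -/
theorem exists_outputs_congr (f : (Fin n → ℝ) × (Fin m → ℝ) → Fin n → ℝ)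
    (g : (Fin n → ℝ) × (Fin m → ℝ) → Fin m → ℝ)
    (ψ : (Fin n → ℝ) × (Fin m → ℝ) → (Fin n → ℝ) × (Fin m → ℝ))
    (φ : OutArg n Q₁ Q₂ → Fin m → ℝ) (k : ℤ) :
    ∃ N : ℕ, ∀ P P' : SysPoint n m, Agree N P P' →
      outputs f g ψ φ P k = outputs f g ψ φ P' k := by
  refine ⟨(∑ j, Q₁ j + ∑ j, (Q₂ j + 1)) + k.natAbs, fun P P' h => ?_⟩
  obtain ⟨h1, h2, h3⟩ := h.shiftSys (f := f) (g := g) (ψ := ψ)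
  have : outArg Q₁ Q₂ (shiftSys f g ψ k P) = outArg Q₁ Q₂ (shiftSys f g ψ k P') := by
    refine Prod.ext (funext fun w => ?_) (Prod.ext h2 (funext fun w => ?_))
    · refine congrFun (h1 _ ?_) w.1
      have := Finset.single_le_sum (f := Q₁) (fun _ _ => Nat.zero_le _) (Finset.mem_univ w.1)
      have := w.2.2
      omega
    · refine congrFun (h3 _ ?_) w.1
      have := Finset.single_le_sum (f := fun j => Q₂ j + 1) (fun _ _ => Nat.zero_le _)
        (Finset.mem_univ w.1)
      have := w.2.2
      omega
  simp only [outputs, this]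

/-! ### The system coordinates as functions on the space of the outputs -/

/-- The coordinates `ζ_[-(k+1)]`, `x`, `u_[k]` expressed by the flat output. -/
def sysOfY (g : (Fin n → ℝ) × (Fin m → ℝ) → Fin m → ℝ)
    (Fx : (Window (lo R₁) (hiPred R₂) → ℝ) → Fin n → ℝ)
    (Fu : (Window (lo R₁) (hi R₂) → ℝ) → Fin m → ℝ) (Y : YPoint m) : SysPoint n m :=
  (fun k => g (stateMap Fx (shiftY (-((k + 1 : ℕ) : ℤ)) Y),
      inputMap Fu (shiftY (-((k + 1 : ℕ) : ℤ)) Y)),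
    stateMap Fx Y, fun k => inputMap Fu (shiftY (k : ℤ) Y))

theorem shiftY_zero (Y : YPoint m) : shiftY 0 Y = Y := by
  funext k; simp [shiftY]

theorem shiftY_eqY (k : ℤ) : shiftY k (eqY g x₀ u₀ φ) = eqY g x₀ u₀ φ := rfl

/-- The shift of the `y` as a continuous linear map. -/
def shiftYCLM (m : ℕ) (k : ℤ) : YPoint m →L[ℝ] YPoint m :=
  ContinuousLinearMap.pi fun i => ContinuousLinearMap.proj (i + k)

/-- The window of the `y` as a continuous linear map. -/
def windowCLM (a b : Fin m → ℤ) : YPoint m →L[ℝ] (Window a b → ℝ) :=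
  ContinuousLinearMap.pi fun w =>
    (ContinuousLinearMap.proj (R := ℝ) (φ := fun _ : Fin m => ℝ) w.1).comp
      (ContinuousLinearMap.proj (R := ℝ) (φ := fun _ : ℤ => Fin m → ℝ) (w.2 : ℤ))

theorem tendsto_shiftY (k : ℤ) :
    Tendsto (shiftY k) (𝓝 (eqY g x₀ u₀ φ)) (𝓝 (eqY g x₀ u₀ φ)) :=
  (shiftYCLM m k).continuous.tendsto (eqY g x₀ u₀ φ)

theorem stateMap_eqY (hf : IsSystem f x₀ u₀) (hg : IsExtension f g ψ x₀ u₀)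
    (hflat : IsFlatOutput f g ψ x₀ u₀ φ Fx Fu) : stateMap Fx (eqY g x₀ u₀ φ) = x₀ := by
  have := hflat.param_x.self_of_nhds
  rw [outputs_eqPoint hf hg] at this
  exact this.symm

theorem inputMap_eqY (hf : IsSystem f x₀ u₀) (hg : IsExtension f g ψ x₀ u₀)
    (hflat : IsFlatOutput f g ψ x₀ u₀ φ Fx Fu) : inputMap Fu (eqY g x₀ u₀ φ) = u₀ := by
  have := hflat.param_u.self_of_nhds
  rw [outputs_eqPoint hf hg] at this
  exact this.symm

theorem strictDiffAt_stateMap (hflat : IsFlatOutput f g ψ x₀ u₀ φ Fx Fu) :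
    ∀ᶠ Y in 𝓝 (eqY g x₀ u₀ φ), StrictDiffAt (stateMap Fx) Y := by
  filter_upwards [((windowCLM (lo R₁) (hiPred R₂)).continuous.tendsto
    (eqY g x₀ u₀ φ)).eventually hflat.smooth_x.strictDiffAt] with Y hY
  exact StrictDiffAt.comp (g := Fx) (f := window _ _) hY (.clm (windowCLM (lo R₁) (hiPred R₂)) Y)

theorem strictDiffAt_inputMap (hflat : IsFlatOutput f g ψ x₀ u₀ φ Fx Fu) :
    ∀ᶠ Y in 𝓝 (eqY g x₀ u₀ φ), StrictDiffAt (inputMap Fu) Y := by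
  filter_upwards [((windowCLM (lo R₁) (hi R₂)).continuous.tendsto
    (eqY g x₀ u₀ φ)).eventually hflat.smooth_u.strictDiffAt] with Y hY
  exact StrictDiffAt.comp (g := Fu) (f := window _ _) hY (.clm (windowCLM (lo R₁) (hi R₂)) Y)

theorem tendsto_stateMap_inputMap (hf : IsSystem f x₀ u₀) (hg : IsExtension f g ψ x₀ u₀)
    (hflat : IsFlatOutput f g ψ x₀ u₀ φ Fx Fu) :
    Tendsto (fun Y => (stateMap Fx Y, inputMap Fu Y)) (𝓝 (eqY g x₀ u₀ φ)) (𝓝 (x₀, u₀)) := by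
  have := ((strictDiffAt_stateMap hflat).self_of_nhds.prodMk
    (strictDiffAt_inputMap hflat).self_of_nhds).continuousAt
  rwa [ContinuousAt, stateMap_eqY hf hg hflat, inputMap_eqY hf hg hflat] at this

theorem strictDiffAt_zeta (hf : IsSystem f x₀ u₀) (hg : IsExtension f g ψ x₀ u₀)
    (hflat : IsFlatOutput f g ψ x₀ u₀ φ Fx Fu) :
    ∀ᶠ Y in 𝓝 (eqY g x₀ u₀ φ), StrictDiffAt (fun Y => g (stateMap Fx Y, inputMap Fu Y)) Y := by
  filter_upwards [(tendsto_stateMap_inputMap hf hg hflat).eventually hg.smooth.strictDiffAt,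
    strictDiffAt_stateMap hflat, strictDiffAt_inputMap hflat] with Y h1 h2 h3
  exact StrictDiffAt.comp (g := g) h1 (h2.prodMk h3)

theorem strictDiffAt_sysOfY_z (hf : IsSystem f x₀ u₀) (hg : IsExtension f g ψ x₀ u₀)
    (hflat : IsFlatOutput f g ψ x₀ u₀ φ Fx Fu) (k : ℕ) :
    ∀ᶠ Y in 𝓝 (eqY g x₀ u₀ φ), StrictDiffAt (fun Y => (sysOfY g Fx Fu Y).1 k) Y := by
  filter_upwards [(tendsto_shiftY (-((k + 1 : ℕ) : ℤ))).eventually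
    (strictDiffAt_zeta hf hg hflat)] with Y hY
  exact StrictDiffAt.comp (g := fun Y => g (stateMap Fx Y, inputMap Fu Y)) (f := shiftY _) hY
    (.clm (shiftYCLM m (-((k + 1 : ℕ) : ℤ))) Y)

theorem strictDiffAt_sysOfY_u (hflat : IsFlatOutput f g ψ x₀ u₀ φ Fx Fu) (k : ℕ) :
    ∀ᶠ Y in 𝓝 (eqY g x₀ u₀ φ), StrictDiffAt (fun Y => (sysOfY g Fx Fu Y).2.2 k) Y := by
  filter_upwards [(tendsto_shiftY (k : ℤ)).eventually
    (strictDiffAt_inputMap hflat)] with Y hY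
  exact StrictDiffAt.comp (g := inputMap Fu) (f := shiftY _) hY (.clm (shiftYCLM m (k : ℤ)) Y)

theorem sysOfY_eqY (hf : IsSystem f x₀ u₀) (hg : IsExtension f g ψ x₀ u₀)
    (hflat : IsFlatOutput f g ψ x₀ u₀ φ Fx Fu) :
    sysOfY g Fx Fu (eqY g x₀ u₀ φ) = eqPoint g x₀ u₀ := by
  simp only [sysOfY, shiftY_eqY, stateMap_eqY hf hg hflat, inputMap_eqY hf hg hflat]
  rfl

/-- The points `Y` and `Y'` have the same coordinates `y_[k]`, `|k| ≤ K`. -/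
def AgreeY (K : ℕ) (Y Y' : YPoint m) : Prop := ∀ k : ℤ, k.natAbs ≤ K → Y k = Y' k

theorem AgreeY.mono {K K' : ℕ} {Y Y' : YPoint m} (h : AgreeY K Y Y') (hK : K' ≤ K) :
    AgreeY K' Y Y' := fun k hk => h k (hk.trans hK)

theorem AgreeY.shiftY {K : ℕ} {k : ℤ} {Y Y' : YPoint m} (h : AgreeY (K + k.natAbs) Y Y') :
    AgreeY K (shiftY k Y) (shiftY k Y') := fun i hi => h _ (by omega)

/-- A bound for the orders of the shifts in the parameterizing map. -/
def orderBound (R₁ R₂ : Fin m → ℕ) : ℕ := ∑ j, R₁ j + ∑ j, R₂ j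

theorem natAbs_le_orderBound {j : Fin m} {k : ℤ} (h1 : lo R₁ j ≤ k) (h2 : k ≤ hi R₂ j) :
    k.natAbs ≤ orderBound R₁ R₂ := by
  have := Finset.single_le_sum (f := R₁) (fun _ _ => Nat.zero_le _) (Finset.mem_univ j)
  have := Finset.single_le_sum (f := R₂) (fun _ _ => Nat.zero_le _) (Finset.mem_univ j)
  simp only [lo, hi, orderBound] at *
  omega

theorem AgreeY.window {Y Y' : YPoint m} (h : AgreeY (orderBound R₁ R₂) Y Y') :
    window (lo R₁) (hi R₂) Y = window (lo R₁) (hi R₂) Y' := by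
  funext w
  obtain ⟨h1, h2⟩ := Finset.mem_Icc.1 w.2.2
  exact congrFun (h _ (natAbs_le_orderBound h1 h2)) _

theorem AgreeY.windowPred {Y Y' : YPoint m} (h : AgreeY (orderBound R₁ R₂) Y Y') :
    DTFlat.window (lo R₁) (hiPred R₂) Y = DTFlat.window (lo R₁) (hiPred R₂) Y' := by
  funext w
  obtain ⟨h1, h2⟩ := Finset.mem_Icc.1 w.2.2
  refine congrFun (h _ (natAbs_le_orderBound h1 ?_)) _
  simp only [hiPred, hi] at *
  omega

theorem AgreeY.stateMap {Y Y' : YPoint m} (h : AgreeY (orderBound R₁ R₂) Y Y') :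
    stateMap Fx Y = stateMap Fx Y' := congrArg Fx h.windowPred

theorem AgreeY.inputMap {Y Y' : YPoint m} (h : AgreeY (orderBound R₁ R₂) Y Y') :
    inputMap Fu Y = inputMap Fu Y' := congrArg Fu h.window

theorem AgreeY.sysOfY {N : ℕ} {Y Y' : YPoint m} (h : AgreeY (orderBound R₁ R₂ + N) Y Y') :
    Agree N (sysOfY g Fx Fu Y) (sysOfY g Fx Fu Y') := by
  refine ⟨fun k hk => ?_, (h.mono (by omega)).stateMap, fun k hk => ?_⟩
  · have h' : AgreeY (orderBound R₁ R₂) (DTFlat.shiftY (-((k + 1 : ℕ) : ℤ)) Y)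
        (DTFlat.shiftY (-((k + 1 : ℕ) : ℤ)) Y') := (h.mono (by omega)).shiftY
    simp only [DTFlat.sysOfY, h'.stateMap (Fx := Fx), h'.inputMap (Fu := Fu)]
  · exact AgreeY.inputMap (h.mono (by omega)).shiftY

/-- Each coordinate commutes with the shift on its own neighbourhood, so only finite windows can be
compared at once. That is enough, since F_x and F_u read a finite window. -/
theorem eventually_agreeY_outputs_shiftSys (hf : IsSystem f x₀ u₀)
    (hg : IsExtension f g ψ x₀ u₀) (K : ℕ) (a : ℤ) :
    ∀ᶠ P in 𝓝 (eqPoint g x₀ u₀),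
      AgreeY K (outputs f g ψ φ (shiftSys f g ψ a P)) (shiftY a (outputs f g ψ φ P)) := by
  have : ∀ᶠ P in 𝓝 (eqPoint g x₀ u₀), ∀ k ∈ Finset.Icc (-(K : ℤ)) K,
      outputs f g ψ φ (shiftSys f g ψ a P) k = outputs f g ψ φ P (k + a) :=
    (Finset.eventually_all _).2 fun k _ => outputs_shiftSys hf hg a k
  filter_upwards [this] with P hP k hk
  exact hP k (Finset.mem_Icc.2 (by omega))

theorem stateMap_shiftY_outputs (hf : IsSystem f x₀ u₀) (hg : IsExtension f g ψ x₀ u₀)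
    (hflat : IsFlatOutput f g ψ x₀ u₀ φ Fx Fu) (a : ℤ) :
    ∀ᶠ P in 𝓝 (eqPoint g x₀ u₀),
      stateMap Fx (shiftY a (outputs f g ψ φ P)) = (shiftSys f g ψ a P).2.1 := by
  filter_upwards [eventually_agreeY_outputs_shiftSys hf hg (orderBound R₁ R₂) a,
    (tendsto_shiftSys hf hg a).eventually hflat.param_x] with P h1 h2
  rw [← h1.stateMap, h2]
  rfl

theorem inputMap_shiftY_outputs (hf : IsSystem f x₀ u₀) (hg : IsExtension f g ψ x₀ u₀)
    (hflat : IsFlatOutput f g ψ x₀ u₀ φ Fx Fu) (a : ℤ) :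
    ∀ᶠ P in 𝓝 (eqPoint g x₀ u₀),
      inputMap Fu (shiftY a (outputs f g ψ φ P)) = (shiftSys f g ψ a P).2.2 0 := by
  filter_upwards [eventually_agreeY_outputs_shiftSys hf hg (orderBound R₁ R₂) a,
    (tendsto_shiftSys hf hg a).eventually hflat.param_u] with P h1 h2
  rw [← h1.inputMap, h2]
  rfl

/-- The coordinate ζ_[-(k+1)] is the value of g(x,u) taken `k + 1` steps earlier; shifting back and
then forward again recovers it. -/
theorem sysOfY_outputs_z (hf : IsSystem f x₀ u₀) (hg : IsExtension f g ψ x₀ u₀)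
    (hflat : IsFlatOutput f g ψ x₀ u₀ φ Fx Fu) (k : ℕ) :
    ∀ᶠ P in 𝓝 (eqPoint g x₀ u₀), (sysOfY g Fx Fu (outputs f g ψ φ P)).1 k = P.1 k := by
  filter_upwards [stateMap_shiftY_outputs hf hg hflat (-((k + 1 : ℕ) : ℤ)),
    inputMap_shiftY_outputs hf hg hflat (-((k + 1 : ℕ) : ℤ)),
    shiftSys_add hf hg ((k + 1 : ℕ) : ℤ) (-((k + 1 : ℕ) : ℤ))] with P h1 h2 h3
  rw [add_neg_cancel, shiftSys_zero, shiftSys_ofNat] at h3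
  simp only [sysOfY, h1, h2]
  rw [← iterate_fwd_z (f := f) (g := g) k, ← h3]
  rfl

theorem sysOfY_outputs_x
    (hflat : IsFlatOutput f g ψ x₀ u₀ φ Fx Fu) :
    ∀ᶠ P in 𝓝 (eqPoint g x₀ u₀), (sysOfY g Fx Fu (outputs f g ψ φ P)).2.1 = P.2.1 :=
  hflat.param_x.mono fun _ h => h.symm

theorem sysOfY_outputs_u (hf : IsSystem f x₀ u₀) (hg : IsExtension f g ψ x₀ u₀)
    (hflat : IsFlatOutput f g ψ x₀ u₀ φ Fx Fu) (k : ℕ) :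
    ∀ᶠ P in 𝓝 (eqPoint g x₀ u₀), (sysOfY g Fx Fu (outputs f g ψ φ P)).2.2 k = P.2.2 k := by
  filter_upwards [inputMap_shiftY_outputs hf hg hflat (k : ℤ)] with P h
  simp only [sysOfY, h]
  rw [shiftSys_ofNat, iterate_fwd_u, zero_add]

theorem eventually_agree_sysOfY_outputs (hf : IsSystem f x₀ u₀) (hg : IsExtension f g ψ x₀ u₀)
    (hflat : IsFlatOutput f g ψ x₀ u₀ φ Fx Fu) (N : ℕ) :
    ∀ᶠ P in 𝓝 (eqPoint g x₀ u₀), Agree N (sysOfY g Fx Fu (outputs f g ψ φ P)) P := by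
  have h1 : ∀ᶠ P in 𝓝 (eqPoint g x₀ u₀), ∀ k ∈ Finset.range N,
      (sysOfY g Fx Fu (outputs f g ψ φ P)).1 k = P.1 k :=
    (Finset.eventually_all _).2 fun k _ => sysOfY_outputs_z hf hg hflat k
  have h3 : ∀ᶠ P in 𝓝 (eqPoint g x₀ u₀), ∀ k ∈ Finset.range N,
      (sysOfY g Fx Fu (outputs f g ψ φ P)).2.2 k = P.2.2 k :=
    (Finset.eventually_all _).2 fun k _ => sysOfY_outputs_u hf hg hflat k
  filter_upwards [h1, sysOfY_outputs_x hflat, h3] with P h1 h2 h3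
  exact ⟨fun k hk => h1 k (Finset.mem_range.2 hk), h2, fun k hk => h3 k (Finset.mem_range.2 hk)⟩

end Outputs

/-! ### Independence of the iterates of a generating family -/

section Orzech

open Polynomial

variable {ι V : Type*} [AddCommGroup V] [Module ℝ V]

/-- Here X acts on `Module.AEval' T` as `T`, so a polynomial relation is the same thing as a finite
real relation among the iterates. -/
theorem linearIndependent_X_pow_smul_iff [Fintype ι] {T : V →ₗ[ℝ] V} {v : ι → Module.AEval' T} :
    LinearIndependent ℝ[X] v ↔
      LinearIndependent ℝ fun p : ℕ × ι => (X ^ p.1 : ℝ[X]) • v p.2 := by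
  constructor
  · intro h
    refine linearIndependent_smul (b := fun k : ℕ => (X ^ k : ℝ[X])) ?_ h
    convert (Polynomial.basisMonomials ℝ).linearIndependent using 1
    funext k
    simp [Polynomial.X_pow_eq_monomial]
  · intro h
    rw [Fintype.linearIndependent_iff]
    intro p hp
    obtain ⟨N, hN⟩ : ∃ N, ∀ j, (p j).natDegree < N := by
      refine ⟨∑ j, (p j).natDegree + 1, fun j => ?_⟩
      have := Finset.single_le_sum (f := fun j => (p j).natDegree) (fun _ _ => Nat.zero_le _)
        (Finset.mem_univ j)
      omega
    have key : ∑ q ∈ Finset.range N ×ˢ Finset.univ,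
        (p q.2).coeff q.1 • ((X ^ q.1 : ℝ[X]) • v q.2) = 0 := by
      rw [Finset.sum_product_right, ← hp]
      refine Finset.sum_congr rfl fun j _ => ?_
      conv_rhs => rw [(p j).as_sum_range_C_mul_X_pow' (hN j), Finset.sum_smul]
      refine Finset.sum_congr rfl fun k _ => ?_
      rw [mul_smul, Module.AEval.C_smul]
    intro j
    ext k
    by_cases hk : k < N
    · exact linearIndependent_iff'.1 h _ _ key (k, j) (by simpa using hk)
    · rw [coeff_zero]
      exact coeff_eq_zero_of_natDegree_lt (by have := hN j; omega)

/-- The span of `y` is finitely generated, the free module on `ι` embeds into it through `u`, and it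
surjects onto it through `y`. The Orzech property makes such a surjection injective. -/
theorem linearIndependent_of_mem_span {R M : Type*} [CommRing R] [AddCommGroup M] [Module R M]
    [Finite ι] {u y : ι → M} (hu : LinearIndependent R u)
    (huy : ∀ j, u j ∈ Submodule.span R (Set.range y)) : LinearIndependent R y := by
  have hr : ∀ c, Finsupp.linearCombination R u c ∈ (Finsupp.linearCombination R y).range := by
    intro c
    rw [Finsupp.range_linearCombination]
    have : Finsupp.linearCombination R u c ∈ Submodule.span R (Set.range u) := by
      rw [← Finsupp.range_linearCombination]
      exact ⟨c, rfl⟩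
    refine Submodule.span_le.2 ?_ this
    rintro _ ⟨j, rfl⟩
    exact huy j
  have := OrzechProperty.injective_of_surjective_of_injective
    ((Finsupp.linearCombination R u).codRestrict _ hr)
    (Finsupp.linearCombination R y).rangeRestrict
    (fun a b hab => hu (congrArg Subtype.val hab)) (LinearMap.surjective_rangeRestrict _)
  exact fun a b hab => this (Subtype.ext hab)

theorem linearIndependent_iterate [Fintype ι] (T : V →ₗ[ℝ] V) {u y : ι → V}
    (hu : LinearIndependent ℝ fun p : ℕ × ι => (T ^ p.1) (u p.2))
    (huy : ∀ j, u j ∈ Submodule.span ℝ (Set.range fun p : ℕ × ι => (T ^ p.1) (y p.2))) :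
    LinearIndependent ℝ fun p : ℕ × ι => (T ^ p.1) (y p.2) := by
  let e := Module.AEval'.of T
  have he : ∀ w : ι → V, (fun p : ℕ × ι => (X ^ p.1 : ℝ[X]) • e (w p.2)) =
      e ∘ fun p : ℕ × ι => (T ^ p.1) (w p.2) := fun w => by
    funext p
    simp only [e, Module.AEval'.X_pow_smul_of]
    rfl
  have hLI : ∀ w : ι → V, LinearIndependent ℝ[X] (fun j => e (w j)) ↔
      LinearIndependent ℝ fun p : ℕ × ι => (T ^ p.1) (w p.2) := fun w => by
    rw [linearIndependent_X_pow_smul_iff, he w]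
    exact LinearMap.linearIndependent_iff _ (LinearEquiv.ker e)
  rw [← hLI] at hu ⊢
  refine linearIndependent_of_mem_span hu fun j => ?_
  have h1 : e (u j) ∈ Submodule.map (e : V →ₗ[ℝ] Module.AEval' T) _ :=
    Submodule.mem_map_of_mem (huy j)
  rw [Submodule.map_span] at h1
  refine (Submodule.span_le (p := (Submodule.span ℝ[X] (Set.range fun j => e (y j))).restrictScalars ℝ)).2 ?_ h1
  rintro _ ⟨_, ⟨p, rfl⟩, rfl⟩
  have := congrFun (he y) p
  simp only [Function.comp] at this
  rw [LinearEquiv.coe_coe, ← this]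
  exact Submodule.smul_mem _ _ (Submodule.subset_span (Set.mem_range_self p.2))

/-- A proper range would lie in the kernel of a nonzero functional, whose coefficients form a linear
relation among the `L i`. -/
theorem surjective_pi_of_linearIndependent {κ E : Type*} [Finite κ] [AddCommGroup E] [Module ℝ E]
    {L : κ → Module.Dual ℝ E} (h : LinearIndependent ℝ L) :
    Function.Surjective (LinearMap.pi L) := by
  have := Fintype.ofFinite κ
  rw [← LinearMap.range_eq_top]
  by_contra hne
  obtain ⟨c, hc, hle⟩ := Submodule.exists_le_ker_of_lt_top _ (lt_top_iff_ne_top.2 hne)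
  classical
  refine hc (LinearMap.pi_ext' fun i => ?_)
  have h1 := Fintype.linearIndependent_iff.1 h (fun i => c (Pi.single i 1)) ?_ i
  · ext; simpa using h1
  · ext v
    have h2 : c (LinearMap.pi L v) = 0 := hle ⟨v, rfl⟩
    rw [LinearMap.pi_apply_eq_sum_univ c] at h2
    have h3 : ∀ i : κ, (fun j => if i = j then (1 : ℝ) else 0) = Pi.single i 1 := fun i => by
      funext j
      simp [Pi.single_apply, eq_comm]
    simpa [mul_comm, h3] using h2

end Orzech

/-! ### The outputs fill a neighbourhood of their equilibrium -/

section FillIn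

variable {n m : ℕ} {f : (Fin n → ℝ) × (Fin m → ℝ) → Fin n → ℝ}
  {g : (Fin n → ℝ) × (Fin m → ℝ) → Fin m → ℝ}
  {ψ : (Fin n → ℝ) × (Fin m → ℝ) → (Fin n → ℝ) × (Fin m → ℝ)}
  {x₀ : Fin n → ℝ} {u₀ : Fin m → ℝ}
  {Q₁ Q₂ R₁ R₂ : Fin m → ℕ} {φ : OutArg n Q₁ Q₂ → Fin m → ℝ}
  {Fx : (Window (lo R₁) (hiPred R₂) → ℝ) → Fin n → ℝ}
  {Fu : (Window (lo R₁) (hi R₂) → ℝ) → Fin m → ℝ}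

/-- The coordinate `y_[k]`. -/
def yCoord (m : ℕ) (k : ℤ) : YPoint m →L[ℝ] (Fin m → ℝ) := ContinuousLinearMap.proj k

/-- The differential of the output `y^j_[k]`, if `D` is the derivative of all outputs. -/
def outForm (D : SysPoint n m →L[ℝ] YPoint m) (k : ℤ) (j : Fin m) :
    Module.Dual ℝ (SysPoint n m) :=
  ((ContinuousLinearMap.proj (R := ℝ) (φ := fun _ : Fin m => ℝ) j).comp
    ((yCoord m k).comp D)).toLinearMap

theorem outForm_apply (D : SysPoint n m →L[ℝ] YPoint m) (k : ℤ) (j : Fin m) (v : SysPoint n m) :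
    outForm D k j v = D v k j := rfl

/-- The differential `du^j_[k]`. -/
def inForm (n : ℕ) {m : ℕ} (k : ℕ) (j : Fin m) : Module.Dual ℝ (SysPoint n m) :=
  ((ContinuousLinearMap.proj (R := ℝ) (φ := fun _ : Fin m => ℝ) j).comp
    (uCoord n m k)).toLinearMap

theorem inForm_apply (k : ℕ) (j : Fin m) (v : SysPoint n m) :
    inForm n k j v = v.2.2 k j := rfl

theorem linearIndependent_inForm (n m : ℕ) :
    LinearIndependent ℝ fun p : ℕ × Fin m => inForm n p.1 p.2 := by
  rw [linearIndependent_iff']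
  intro s c hc p hp
  have h := LinearMap.congr_fun hc
    ((0, 0, Pi.single p.1 (Pi.single p.2 1)) : SysPoint n m)
  rw [LinearMap.sum_apply, Finset.sum_eq_single p] at h
  · simpa [inForm_apply] using h
  · intro q _ hq
    rw [LinearMap.smul_apply, inForm_apply]
    by_cases h1 : q.1 = p.1
    · have h2 : q.2 ≠ p.2 := fun h2 => hq (Prod.ext h1 h2)
      simp [h1, h2]
    · simp [h1]
  · exact fun h => absurd hp h

theorem outputs_deriv_shift (hf : IsSystem f x₀ u₀) (hg : IsExtension f g ψ x₀ u₀)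
    {D : SysPoint n m →L[ℝ] YPoint m} {σ : SysPoint n m →L[ℝ] SysPoint n m}
    (hD : HasStrictFDerivAt (outputs f g ψ φ) D (eqPoint g x₀ u₀))
    (hσ : HasStrictFDerivAt (fwd f g) σ (eqPoint g x₀ u₀)) (k : ℤ) (v : SysPoint n m) :
    D (σ v) k = D v (k + 1) := by
  have hk : ∀ k, HasStrictFDerivAt (fun P => outputs f g ψ φ P k) ((yCoord m k).comp D)
      (eqPoint g x₀ u₀) := fun k => strict_comp (strict_clm (yCoord m k) _) hD
  have h1 : HasStrictFDerivAt (fun P => outputs f g ψ φ (fwd f g P) k)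
      (((yCoord m k).comp D).comp σ) (eqPoint g x₀ u₀) := by
    refine strict_comp (g := fun P => outputs f g ψ φ P k) ?_ hσ
    rw [fwd_eqPoint hf]
    exact hk k
  have h2 : (fun P => outputs f g ψ φ (fwd f g P) k) =ᶠ[𝓝 (eqPoint g x₀ u₀)]
      fun P => outputs f g ψ φ P (k + 1) := outputs_shiftSys hf hg 1 k
  exact congrArg (fun L => L v) (strict_unique (strict_congr h1 h2) (hk (k + 1)))

theorem fwd_deriv_u
    {σ : SysPoint n m →L[ℝ] SysPoint n m}
    (hσ : HasStrictFDerivAt (fwd f g) σ (eqPoint g x₀ u₀)) (k : ℕ) (v : SysPoint n m) :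
    (σ v).2.2 k = v.2.2 (k + 1) := by
  have h1 := strict_comp (strict_clm (uCoord n m k) _) hσ
  exact congrArg (fun L => L v) (strict_unique h1 (strict_clm (uCoord n m (k + 1)) _))

/-- This is the differential of u = F_u(y_[-R₁,R₂]) at the equilibrium. -/
theorem inForm_mem_span (hf : IsSystem f x₀ u₀) (hg : IsExtension f g ψ x₀ u₀)
    (hflat : IsFlatOutput f g ψ x₀ u₀ φ Fx Fu) {D : SysPoint n m →L[ℝ] YPoint m}
    (hD : HasStrictFDerivAt (outputs f g ψ φ) D (eqPoint g x₀ u₀)) (j : Fin m) :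
    inForm n 0 j ∈ Submodule.span ℝ
      {η | ∃ (k : ℤ) (l : Fin m), k.natAbs ≤ orderBound R₁ R₂ ∧ η = outForm D k l} := by
  obtain ⟨A, hA⟩ := hflat.smooth_u.strictDiffAt.self_of_nhds
  have h1 : HasStrictFDerivAt (fun P => Fu (window (lo R₁) (hi R₂) (outputs f g ψ φ P)))
      (A.comp ((windowCLM (lo R₁) (hi R₂)).comp D)) (eqPoint g x₀ u₀) := by
    refine strict_comp (g := Fu) (f := fun P => window (lo R₁) (hi R₂) (outputs f g ψ φ P)) ?_
      (strict_comp (g := window (lo R₁) (hi R₂)) (strict_clm (windowCLM (lo R₁) (hi R₂)) _) hD)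
    rwa [outputs_eqPoint hf hg]
  have h2 : (fun P => Fu (window (lo R₁) (hi R₂) (outputs f g ψ φ P)))
      =ᶠ[𝓝 (eqPoint g x₀ u₀)] uCoord n m 0 := hflat.param_u.mono fun P hP => hP.symm
  have h3 := strict_unique (strict_congr h1 h2) (strict_clm (uCoord n m 0) _)
  have h4 : inForm n 0 j = ∑ w : Window (lo R₁) (hi R₂),
      A (fun i => if w = i then 1 else 0) j • outForm D (w.2 : ℤ) w.1 := by
    refine LinearMap.ext fun v => ?_
    have h5 : inForm n 0 j v = A (window (lo R₁) (hi R₂) (D v)) j :=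
      congrArg (fun L : SysPoint n m →L[ℝ] (Fin m → ℝ) => L v j) h3.symm
    rw [h5, ← ContinuousLinearMap.coe_coe A, LinearMap.pi_apply_eq_sum_univ,
      Finset.sum_apply, LinearMap.sum_apply]
    refine Finset.sum_congr rfl fun w _ => ?_
    simp [outForm_apply, window, mul_comm]
  rw [h4]
  refine Submodule.sum_mem _ fun w _ => Submodule.smul_mem _ _ (Submodule.subset_span ?_)
  obtain ⟨h6, h7⟩ := Finset.mem_Icc.1 w.2.2
  exact ⟨_, _, natAbs_le_orderBound h6 h7, rfl⟩

/-- The transpose `T` of the derivative of the forward shift sends du_[k] to du_[k+1] and dy_[k] to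
dy_[k+1]. Thus `linearIndependent_iterate` applies with generators du and dy_[-N]. -/
theorem linearIndependent_outForm (hf : IsSystem f x₀ u₀) (hg : IsExtension f g ψ x₀ u₀)
    (hflat : IsFlatOutput f g ψ x₀ u₀ φ Fx Fu) {D : SysPoint n m →L[ℝ] YPoint m}
    (hD : HasStrictFDerivAt (outputs f g ψ φ) D (eqPoint g x₀ u₀)) {N : ℕ}
    (hN : orderBound R₁ R₂ ≤ N) :
    LinearIndependent ℝ fun p : ℕ × Fin m => outForm D (p.1 - N) p.2 := by
  obtain ⟨σ, hσ⟩ := (strictDiffAt_fwd hf hg).self_of_nhds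
  let T : Module.Dual ℝ (SysPoint n m) →ₗ[ℝ] Module.Dual ℝ (SysPoint n m) :=
    Module.Dual.transpose σ.toLinearMap
  have hT : ∀ (η : Module.Dual ℝ (SysPoint n m)) v, T η v = η (σ v) := fun _ _ => rfl
  have hin : ∀ (k : ℕ) (j : Fin m), (T ^ k) (inForm n 0 j) = inForm n k j := by
    intro k j
    induction k with
    | zero => rfl
    | succ k ih =>
      rw [pow_succ', Module.End.mul_apply, ih]
      refine LinearMap.ext fun v => ?_
      rw [hT, inForm_apply, inForm_apply, fwd_deriv_u hσ]
  have hout : ∀ (k : ℕ) (j : Fin m), (T ^ k) (outForm D (-N) j) = outForm D (k - N) j := by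
    intro k j
    induction k with
    | zero => simp
    | succ k ih =>
      rw [pow_succ', Module.End.mul_apply, ih]
      refine LinearMap.ext fun v => ?_
      rw [hT, outForm_apply, outForm_apply, outputs_deriv_shift hf hg hD hσ,
        show (k : ℤ) - N + 1 = ((k + 1 : ℕ) : ℤ) - N by push_cast; ring]
  have h := linearIndependent_iterate T (u := inForm n 0) (y := outForm D (-N))
    (by simpa only [hin] using linearIndependent_inForm n m) ?_
  · simpa only [hout] using h
  · intro j
    refine Submodule.span_mono ?_ (inForm_mem_span hf hg hflat hD j)
    rintro _ ⟨k, l, hk, rfl⟩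
    -- `T` only raises orders, so the generators must start below every order occurring in F_u; `hN`
    -- gives k + N ≥ 0, and `toNat` loses nothing.
    refine ⟨((k + N).toNat, l), ?_⟩
    simp only [hout]
    congr 1
    omega

theorem outputs_deriv_surjective (hf : IsSystem f x₀ u₀) (hg : IsExtension f g ψ x₀ u₀)
    (hflat : IsFlatOutput f g ψ x₀ u₀ φ Fx Fu) {D : SysPoint n m →L[ℝ] YPoint m}
    (hD : HasStrictFDerivAt (outputs f g ψ φ) D (eqPoint g x₀ u₀)) (K : ℕ)
    (w : YPoint m) : ∃ v, AgreeY K (D v) w := by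
  have h1 : LinearIndependent ℝ fun p : ↥(Finset.Icc (-(K : ℤ)) K) × Fin m =>
      outForm D p.1 p.2 := by
    -- The summand `orderBound R₁ R₂` meets the requirement of that lemma; the summand `K` lowers
    -- the starting order to at most -K.
    have h2 := linearIndependent_outForm hf hg hflat hD
      (N := orderBound R₁ R₂ + K) (by omega)
    have h3 := h2.comp
      (fun p : ↥(Finset.Icc (-(K : ℤ)) K) × Fin m =>
        (((p.1 : ℤ) + (orderBound R₁ R₂ + K : ℕ)).toNat, p.2)) ?_
    · convert h3 using 2 with p
      have := Finset.mem_Icc.1 p.1.2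
      simp only [Function.comp]
      congr 1
      omega
    · intro p q hpq
      have hp := Finset.mem_Icc.1 p.1.2
      have hq := Finset.mem_Icc.1 q.1.2
      obtain ⟨h4, h5⟩ := Prod.ext_iff.1 hpq
      refine Prod.ext (Subtype.ext ?_) h5
      simp only at h4
      omega
  obtain ⟨v, hv⟩ := surjective_pi_of_linearIndependent h1 fun p => w p.1 p.2
  refine ⟨v, fun k hk => funext fun j => ?_⟩
  exact congrFun hv (⟨k, Finset.mem_Icc.2 (by omega)⟩, j)

/-- A property of finitely many `y_[k]` that holds for the outputs of all points near the
equilibrium holds on a neighbourhood of the equilibrium. -/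
theorem eventually_of_outputs (hf : IsSystem f x₀ u₀) (hg : IsExtension f g ψ x₀ u₀)
    (hflat : IsFlatOutput f g ψ x₀ u₀ φ Fx Fu) {p : YPoint m → Prop} {K : ℕ}
    (hp : ∀ Y Y', AgreeY K Y Y' → p Y → p Y')
    (h : ∀ᶠ P in 𝓝 (eqPoint g x₀ u₀), p (outputs f g ψ φ P)) :
    ∀ᶠ Y in 𝓝 (eqY g x₀ u₀ φ), p Y := by
  obtain ⟨D, hD⟩ := strictDiffAt_outputs_eqPoint hf hg hflat.smooth_out
  let V := ↥(Finset.Icc (-(K : ℤ)) K) → Fin m → ℝ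
  let res : YPoint m →L[ℝ] V := ContinuousLinearMap.pi fun k => yCoord m k
  have hres : ∀ Y Y', res Y = res Y' → AgreeY K Y Y' := fun Y Y' hY k hk =>
    congrFun hY ⟨k, Finset.mem_Icc.2 (by omega)⟩
  have hsurj : Function.Surjective (res.comp D).toLinearMap := by
    intro w
    obtain ⟨v, hv⟩ := outputs_deriv_surjective hf hg hflat hD K
      (fun k => if hk : k ∈ Finset.Icc (-(K : ℤ)) K then w ⟨k, hk⟩ else 0)
    refine ⟨v, funext fun k => ?_⟩
    have := hv k (by have := Finset.mem_Icc.1 k.2; omega)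
    exact this.trans (dif_pos k.2)
  obtain ⟨s, hs⟩ := LinearMap.exists_rightInverse_of_surjective _ (LinearMap.range_eq_top.2 hsurj)
  -- The right inverse cuts out a finite-dimensional affine slice through the equilibrium.
  -- Restricted to it, the windowed outputs form a map `V → V` whose derivative at 0 is the
  -- identity, so its image contains a neighbourhood.
  let s' : V →L[ℝ] SysPoint n m := ⟨s, s.continuous_of_finiteDimensional⟩
  have hstrans : HasStrictFDerivAt (fun v => eqPoint g x₀ u₀ + s' v) s' 0 :=
    .of_isLittleOTVS <| (Asymptotics.IsLittleOTVS.zero _ _).congr_left <| by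
      intro q; simp
  have h0 : eqPoint g x₀ u₀ + s' 0 = eqPoint g x₀ u₀ := by simp
  have hG : HasStrictFDerivAt (fun v => res (outputs f g ψ φ (eqPoint g x₀ u₀ + s' v)))
      ((res.comp D).comp s') 0 := by
    refine strict_comp (g := fun P => res (outputs f g ψ φ P)) ?_ hstrans
    rw [h0]
    exact strict_comp (strict_clm res _) hD
  have hmap := hG.map_nhds_eq_of_surj (LinearMap.range_eq_top.2 fun w =>
    ⟨w, LinearMap.congr_fun hs w⟩)
  rw [h0, outputs_eqPoint hf hg] at hmap
  have ht : Tendsto (fun v => eqPoint g x₀ u₀ + s' v) (𝓝 0) (𝓝 (eqPoint g x₀ u₀)) := by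
    have := hstrans.continuousAt
    rwa [ContinuousAt, h0] at this
  have h1 : ∀ᶠ w in 𝓝 (res (eqY g x₀ u₀ φ)), ∃ Y, res Y = w ∧ p Y := by
    rw [← hmap, eventually_map]
    filter_upwards [ht.eventually h] with v hv
    exact ⟨_, rfl, hv⟩
  filter_upwards [(res.continuous.tendsto _).eventually h1] with Z ⟨Y, hY, hpY⟩
  exact hp Y Z (hres _ _ hY) hpY

end FillIn

/-! ### Linear forms and their coefficients -/

section Coefficients

variable {m : ℕ}

/-- The tangent vector `∂/∂y^j_[k]`. -/
noncomputable def unitY (p : ℤ × Fin m) : YPoint m := Pi.single p.1 (Pi.single p.2 1)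

/-- The coefficients of a linear form. -/
noncomputable def coeffs (m : ℕ) : Module.Dual ℝ (YPoint m) →ₗ[ℝ] (ℤ × Fin m → ℝ) :=
  LinearMap.pi fun p => LinearMap.applyₗ (unitY p)

theorem diffl_eq_coeffs {h : YPoint m → ℝ} {L : YPoint m →L[ℝ] ℝ} {Y : YPoint m}
    (hL : HasStrictFDerivAt h L Y) : diffl h Y = coeffs m L.toLinearMap :=
  funext fun _ => lineDeriv_eq_of_strict hL _

/-- Continuity is essential: a vector is in general only the limit of finite combinations of the
`unitY p`. -/
theorem eq_zero_of_coeffs_eq_zero {L : YPoint m →L[ℝ] ℝ} (h : coeffs m L.toLinearMap = 0) :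
    L = 0 := by
  ext w
  have h1 : HasSum (fun k : ℤ => (Pi.single k (w k) : YPoint m)) w := by
    rw [Pi.hasSum]
    intro i
    convert hasSum_single (f := fun k : ℤ => (Pi.single k (w k) : YPoint m) i) i ?_ using 1
    · simp
    · intro k hk
      simp [Pi.single_eq_of_ne hk.symm]
  have h2 : ∀ k : ℤ, L (Pi.single k (w k)) = 0 := fun k => by
    have h3 : (Pi.single k (w k) : YPoint m) = ∑ j, w k j • unitY (k, j) := by
      funext i l
      by_cases hi : i = k
      · subst hi
        simp [unitY, Finset.sum_apply, Pi.single_apply]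
      · simp [unitY, Finset.sum_apply, hi]
    rw [h3, map_sum]
    refine Finset.sum_eq_zero fun j _ => ?_
    have := congrFun h (k, j)
    rw [map_smul, show L (unitY (k, j)) = 0 from this, smul_zero]
  have h4 := h1.mapL L
  simp only [h2] at h4
  exact h4.unique hasSum_zero

end Coefficients

/-! ### Spans of subfamilies of an independent family -/

/-- By independence on `s ∪ t`, the expansions over `s` and over `t` of a common element coincide,
so their support lies in both sets. -/
theorem span_image_inf_le {ι V : Type*} [AddCommGroup V] [Module ℝ V] {v : ι → V} {s t : Set ι}
    (h : LinearIndepOn ℝ v (s ∪ t)) :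
    Submodule.span ℝ (v '' s) ⊓ Submodule.span ℝ (v '' t) ≤ Submodule.span ℝ (v '' (s ∩ t)) := by
  rintro x ⟨hs, ht⟩
  obtain ⟨a, ha, rfl⟩ := (Finsupp.mem_span_image_iff_linearCombination ℝ).1 hs
  obtain ⟨b, hb, hab⟩ := (Finsupp.mem_span_image_iff_linearCombination ℝ).1 ht
  have : a = b := by
    refine linearIndepOn_iffₛ.1 h a ?_ b ?_ hab.symm
    · exact Finsupp.supported_mono Set.subset_union_left ha
    · exact Finsupp.supported_mono Set.subset_union_right hb
  subst this
  refine (Finsupp.mem_span_image_iff_linearCombination ℝ).2 ⟨a, ?_, rfl⟩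
  rw [Finsupp.supported_inter]
  exact ⟨ha, hb⟩

/-- A minimal element equals its infimum with any other member, hence lies below it. -/
theorem exists_isLeast_of_inf_mem {α : Type*} [SemilatticeInf α] [WellFoundedLT α] {S : Set α}
    (hne : S.Nonempty) (hinf : ∀ a ∈ S, ∀ b ∈ S, a ⊓ b ∈ S) : ∃ a, IsLeast S a := by
  obtain ⟨a, ha, hmin⟩ := WellFounded.has_min (wellFounded_lt (α := α)) S hne
  refine ⟨a, ha, fun b hb => ?_⟩
  have h := hmin _ (hinf a ha b hb)
  exact inf_eq_left.1 (eq_of_le_of_not_lt inf_le_left h)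

/-! ### The forms generating the right-hand side of the span condition -/

section Forms

variable {n m : ℕ} {f : (Fin n → ℝ) × (Fin m → ℝ) → Fin n → ℝ}
  {g : (Fin n → ℝ) × (Fin m → ℝ) → Fin m → ℝ}
  {ψ : (Fin n → ℝ) × (Fin m → ℝ) → (Fin n → ℝ) × (Fin m → ℝ)}
  {x₀ : Fin n → ℝ} {u₀ : Fin m → ℝ}
  {Q₁ Q₂ R₁ R₂ : Fin m → ℕ} {φ : OutArg n Q₁ Q₂ → Fin m → ℝ}
  {Fx : (Window (lo R₁) (hiPred R₂) → ℝ) → Fin n → ℝ}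
  {Fu : (Window (lo R₁) (hi R₂) → ℝ) → Fin m → ℝ}

/-- Index set of the scalar coordinates `ζ^j_[-(k+1)]`, `x^i`, `u^j_[k]`. -/
abbrev SysIndex (n m : ℕ) : Type := (ℕ × Fin m) ⊕ Fin n ⊕ (ℕ × Fin m)

/-- The scalar coordinates of the system space. -/
def sysCoord (n m : ℕ) : SysIndex n m → SysPoint n m →L[ℝ] ℝ
  | .inl p => (ContinuousLinearMap.proj (R := ℝ) (φ := fun _ : Fin m => ℝ) p.2).comp
      (zCoord n m p.1)
  | .inr (.inl i) => (ContinuousLinearMap.proj (R := ℝ) (φ := fun _ : Fin n => ℝ) i).comp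
      (xCoord n m)
  | .inr (.inr p) => (ContinuousLinearMap.proj (R := ℝ) (φ := fun _ : Fin m => ℝ) p.2).comp
      (uCoord n m p.1)

/-- The coordinate vectors of the system space. -/
noncomputable def sysUnit (n m : ℕ) : SysIndex n m → SysPoint n m
  | .inl p => (Pi.single p.1 (Pi.single p.2 1), 0, 0)
  | .inr (.inl i) => (0, Pi.single i 1, 0)
  | .inr (.inr p) => (0, 0, Pi.single p.1 (Pi.single p.2 1))

theorem sysCoord_sysUnit (i i' : SysIndex n m) :
    sysCoord n m i' (sysUnit n m i) = if i' = i then 1 else 0 := by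
  have h : ∀ p q : ℕ × Fin m, (Pi.single p.1 (Pi.single p.2 1) : ℕ → Fin m → ℝ) q.1 q.2 =
      if q = p then 1 else 0 := by
    intro p q
    by_cases h1 : q.1 = p.1
    · rw [h1, Pi.single_eq_same, Pi.single_apply]
      simp [Prod.ext_iff, h1]
    · simp [h1, Prod.ext_iff]
  rcases i with p | i | p <;> rcases i' with p' | i' | p' <;>
    simp only [sysUnit, sysCoord, reduceCtorEq, if_false, Sum.inl.injEq, Sum.inr.injEq]
  · exact h p p'
  · rfl
  · rfl
  · rfl
  · exact Pi.single_apply _ _ _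
  · rfl
  · rfl
  · rfl
  · exact h p p'

/-- The order of a coordinate of the system space. -/
def sysOrder {n m : ℕ} : SysIndex n m → ℕ
  | .inl p => p.1
  | .inr (.inl _) => 0
  | .inr (.inr p) => p.1

theorem finite_sysOrder_lt (N : ℕ) : {i : SysIndex n m | sysOrder i < N}.Finite := by
  have h : (Set.univ : Set (Fin N × Fin m ⊕ Fin n ⊕ Fin N × Fin m)).Finite := Set.finite_univ
  refine (h.image (Sum.map (Prod.map Fin.val id) (Sum.map id (Prod.map Fin.val id)))).subset ?_
  rintro (p | i | p) hp
  · exact ⟨.inl (⟨p.1, hp⟩, p.2), trivial, rfl⟩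
  · exact ⟨.inr (.inl i), trivial, rfl⟩
  · exact ⟨.inr (.inr (⟨p.1, hp⟩, p.2)), trivial, rfl⟩

theorem Agree.sysCoord {N : ℕ} {P P' : SysPoint n m} (h : Agree N P P') {i : SysIndex n m}
    (hi : sysOrder i < N) : sysCoord n m i P = sysCoord n m i P' := by
  rcases i with p | i | p
  · exact congrFun (h.1 p.1 hi) p.2
  · exact congrFun h.2.1 i
  · exact congrFun (h.2.2 p.1 hi) p.2

/-- The generating forms of the span on the right-hand side. -/
noncomputable def sysForm (g : (Fin n → ℝ) × (Fin m → ℝ) → Fin m → ℝ)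
    (Fx : (Window (lo R₁) (hiPred R₂) → ℝ) → Fin n → ℝ)
    (Fu : (Window (lo R₁) (hi R₂) → ℝ) → Fin m → ℝ) (Y : YPoint m) (i : SysIndex n m) :
    ℤ × Fin m → ℝ :=
  diffl (fun Z => sysCoord n m i (sysOfY g Fx Fu Z)) Y

/-- Indices of the generating forms occurring for the multi-indices `M`. -/
def sysIndices (n : ℕ) {m : ℕ} (M : (Fin m → ℕ) × (Fin m → ℕ)) : Set (SysIndex n m) :=
  {i | match i with
    | .inl p => p.1 + 1 ≤ M.1 p.2
    | .inr (.inl _) => True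
    | .inr (.inr p) => p.1 ≤ M.2 p.2}

theorem systemSpan_eq (M : (Fin m → ℕ) × (Fin m → ℕ)) (Y : YPoint m) :
    systemSpan g Fx Fu M.1 M.2 Y = Submodule.span ℝ (sysForm g Fx Fu Y '' sysIndices n M) := by
  rw [systemSpan]
  congr 1
  ext η
  constructor
  · rintro ((⟨j, k, h1, h2, rfl⟩ | ⟨i, rfl⟩) | ⟨j, k, h, rfl⟩)
    · obtain ⟨k, rfl⟩ := Nat.exists_eq_add_of_le' h1
      exact ⟨.inl (k, j), h2, rfl⟩
    · exact ⟨.inr (.inl i), trivial, rfl⟩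
    · exact ⟨.inr (.inr (k, j)), h, rfl⟩
  · rintro ⟨i, hi, rfl⟩
    rcases i with p | i | p
    · exact .inl (.inl ⟨p.2, p.1 + 1, by omega, hi, rfl⟩)
    · exact .inl (.inr ⟨i, rfl⟩)
    · exact .inr ⟨p.2, p.1, hi, rfl⟩

theorem strictDiffAt_sysCoord_sysOfY (hf : IsSystem f x₀ u₀) (hg : IsExtension f g ψ x₀ u₀)
    (hflat : IsFlatOutput f g ψ x₀ u₀ φ Fx Fu) (i : SysIndex n m) :
    ∀ᶠ Y in 𝓝 (eqY g x₀ u₀ φ), StrictDiffAt (fun Y => sysCoord n m i (sysOfY g Fx Fu Y)) Y := by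
  rcases i with p | i | p
  · filter_upwards [strictDiffAt_sysOfY_z hf hg hflat p.1] with Y hY
    exact StrictDiffAt.comp (f := fun Y => (sysOfY g Fx Fu Y).1 p.1)
      (.clm (ContinuousLinearMap.proj (R := ℝ) (φ := fun _ : Fin m => ℝ) p.2) _) hY
  · filter_upwards [strictDiffAt_stateMap hflat] with Y hY
    exact StrictDiffAt.comp (f := stateMap Fx)
      (.clm (ContinuousLinearMap.proj (R := ℝ) (φ := fun _ : Fin n => ℝ) i) _) hY
  · filter_upwards [strictDiffAt_sysOfY_u hflat p.1] with Y hY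
    exact StrictDiffAt.comp (f := fun Y => (sysOfY g Fx Fu Y).2.2 p.1)
      (.clm (ContinuousLinearMap.proj (R := ℝ) (φ := fun _ : Fin m => ℝ) p.2) _) hY

/-- Replaces the coordinates `y_[k]`, `|k| ≤ K`, of `B` by those of `A`. -/
def patch {m : ℕ} (K : ℕ) (A B : YPoint m) : YPoint m :=
  fun k => if k.natAbs ≤ K then A k else B k

theorem agreeY_patch (K : ℕ) (A B : YPoint m) : AgreeY K A (patch K A B) :=
  fun _ hk => (if_pos hk).symm

theorem patch_self (K : ℕ) (A : YPoint m) : patch K A A = A := by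
  funext k; simp [patch]

theorem AgreeY.sysCoord {N K : ℕ} {Y Y' : YPoint m} (hK : orderBound R₁ R₂ + N ≤ K)
    (h : AgreeY K Y Y') {i : SysIndex n m} (hi : sysOrder i < N) :
    DTFlat.sysCoord n m i (DTFlat.sysOfY g Fx Fu Y) =
      DTFlat.sysCoord n m i (DTFlat.sysOfY g Fx Fu Y') :=
  (AgreeY.sysOfY (N := N) (h.mono hK)).sysCoord hi

/-- Near the equilibrium there are tangent vectors dual to any finite set of generating forms. -/
theorem exists_dual_vectors (hf : IsSystem f x₀ u₀) (hg : IsExtension f g ψ x₀ u₀)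
    (hflat : IsFlatOutput f g ψ x₀ u₀ φ Fx Fu) (N : ℕ) :
    ∀ᶠ Y in 𝓝 (eqY g x₀ u₀ φ), ∀ i : SysIndex n m, ∃ w : YPoint m,
      ∀ i' : SysIndex n m, sysOrder i' < N →
        lineDeriv ℝ (fun Z => sysCoord n m i' (sysOfY g Fx Fu Z)) Y w = if i' = i then 1 else 0 := by
  set K := orderBound R₁ R₂ + N with hK
  refine eventually_of_outputs hf hg hflat (K := K) ?_ ?_
  · intro Y Y' hYY' h i
    obtain ⟨w, hw⟩ := h i
    refine ⟨w, fun i' hi' => ?_⟩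
    -- The coordinate functions read only y_[k] with |k| ≤ K, so the two functions of t being
    -- differentiated are the same.
    rw [← hw i' hi', lineDeriv, lineDeriv]
    congr 1
    funext t
    refine AgreeY.sysCoord le_rfl (fun k hk => ?_) hi'
    rw [Pi.add_apply, Pi.add_apply, hYY' k hk]
  · have h1 : ∀ᶠ P in 𝓝 (eqPoint g x₀ u₀), ∀ k ∈ Finset.Icc (-(K : ℤ)) K,
        StrictDiffAt (fun P => outputs f g ψ φ P k) P :=
      (Finset.eventually_all _).2 fun k _ => strictDiffAt_outputs hf hg hflat.smooth_out k
    have h2 : ∀ᶠ Y in 𝓝 (eqY g x₀ u₀ φ), ∀ i' : SysIndex n m, sysOrder i' < N →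
        StrictDiffAt (fun Y => sysCoord n m i' (sysOfY g Fx Fu Y)) Y := by
      exact (finite_sysOrder_lt N).eventually_all.2 fun i' _ => strictDiffAt_sysCoord_sysOfY hf hg hflat i'
    filter_upwards [h1, (tendsto_outputs hf hg hflat.smooth_out).eventually h2,
      (eventually_agree_sysOfY_outputs hf hg hflat N).eventually_nhds] with P hP1 hP2 hP3 i
    -- At `P` only finitely many outputs are known to be differentiable. The remaining ones are
    -- frozen at their values at `P`, which the relevant coordinates of `sysOfY` do not notice. The
    -- dual vectors are then the images of the coordinate vectors, because `sysOfY` undoes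
    -- `outputs`.
    have h3 : StrictDiffAt (fun Q => patch K (outputs f g ψ φ Q) (outputs f g ψ φ P)) P := by
      refine StrictDiffAt.pi fun k => ?_
      by_cases hk : k.natAbs ≤ K
      · simp only [patch, if_pos hk]
        exact hP1 k (Finset.mem_Icc.2 (by omega))
      · simp only [patch, if_neg hk]
        exact .const _ _
    obtain ⟨D, hD⟩ := h3
    refine ⟨D (sysUnit n m i), fun i' hi' => ?_⟩
    obtain ⟨L, hL⟩ := hP2 i' hi'
    rw [lineDeriv_eq_of_strict hL]
    have h4 : HasStrictFDerivAt (fun Q => sysCoord n m i'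
        (sysOfY g Fx Fu (patch K (outputs f g ψ φ Q) (outputs f g ψ φ P)))) (L.comp D) P := by
      refine strict_comp (g := fun Y => sysCoord n m i' (sysOfY g Fx Fu Y)) ?_ hD
      rwa [patch_self]
    have h5 : (fun Q => sysCoord n m i'
        (sysOfY g Fx Fu (patch K (outputs f g ψ φ Q) (outputs f g ψ φ P)))) =ᶠ[𝓝 P]
        sysCoord n m i' := by
      filter_upwards [hP3] with Q hQ
      rw [← hQ.sysCoord hi']
      exact (AgreeY.sysCoord le_rfl (agreeY_patch K _ _) hi').symm
    rw [← sysCoord_sysUnit]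
    exact congrArg (fun A => A (sysUnit n m i))
      (strict_unique (strict_congr h4 h5) (strict_clm _ _))

theorem linearIndepOn_sysForm (hf : IsSystem f x₀ u₀) (hg : IsExtension f g ψ x₀ u₀)
    (hflat : IsFlatOutput f g ψ x₀ u₀ φ Fx Fu) (N : ℕ) :
    ∀ᶠ Y in 𝓝 (eqY g x₀ u₀ φ), LinearIndepOn ℝ (sysForm g Fx Fu Y) {i | sysOrder i < N} := by
  have h2 : ∀ᶠ Y in 𝓝 (eqY g x₀ u₀ φ), ∀ i ∈ {i : SysIndex n m | sysOrder i < N},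
      StrictDiffAt (fun Y => sysCoord n m i (sysOfY g Fx Fu Y)) Y :=
    (finite_sysOrder_lt N).eventually_all.2 fun i' _ => strictDiffAt_sysCoord_sysOfY hf hg hflat i'
  filter_upwards [exists_dual_vectors hf hg hflat N, h2] with Y hY hs
  choose! L hL using hs
  have hform : ∀ i ∈ {i : SysIndex n m | sysOrder i < N},
      sysForm g Fx Fu Y i = coeffs m (L i).toLinearMap := fun i hi => diffl_eq_coeffs (hL i hi)
  rw [linearIndepOn_iff']
  intro t c ht hc i hi
  -- The relation is lifted from coefficients to forms before evaluation, since the dual vector `w`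
  -- is not known to have finite support.
  have h3 : (∑ i ∈ t, c i • L i) = 0 := by
    refine eq_zero_of_coeffs_eq_zero ?_
    rw [← hc, ContinuousLinearMap.toLinearMap_sum, map_sum]
    refine Finset.sum_congr rfl fun i hi => ?_
    rw [hform i (ht hi), ContinuousLinearMap.toLinearMap_smul, map_smul]
  obtain ⟨w, hw⟩ := hY i
  have h4 := congrArg (fun A : YPoint m →L[ℝ] ℝ => A w) h3
  simp only [sum_apply, smul_apply,
    zero_apply] at h4
  rw [Finset.sum_eq_single i] at h4
  · rw [← lineDeriv_eq_of_strict (hL i (ht hi)), hw i (ht hi), if_pos rfl] at h4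
    simpa using h4
  · intro i' hi' hne
    rw [← lineDeriv_eq_of_strict (hL i' (ht hi')), hw i' (ht hi'), if_neg hne, smul_zero]
  · exact fun h => absurd hi h

theorem sysIndices_subset (M : (Fin m → ℕ) × (Fin m → ℕ)) :
    sysIndices n M ⊆ {i | sysOrder i < ∑ j, M.1 j + ∑ j, M.2 j + 1} := by
  intro i hi
  have h1 := fun j => Finset.single_le_sum (f := M.1) (fun _ _ => Nat.zero_le _)
    (Finset.mem_univ j)
  have h2 := fun j => Finset.single_le_sum (f := M.2) (fun _ _ => Nat.zero_le _)
    (Finset.mem_univ j)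
  rcases i with p | i | p
  · have := h1 p.2
    have : p.1 + 1 ≤ M.1 p.2 := hi
    simp only [Set.mem_ofPred_eq, sysOrder]
    omega
  · simp [sysOrder]
  · have := h2 p.2
    have : p.1 ≤ M.2 p.2 := hi
    simp only [Set.mem_ofPred_eq, sysOrder]
    omega

/-- The index set of an infimum contains the intersection of the two index sets, and independence
turns the intersection of spans into the span over that intersection. -/
theorem inf_mem_spanOrders (hf : IsSystem f x₀ u₀) (hg : IsExtension f g ψ x₀ u₀)
    (hflat : IsFlatOutput f g ψ x₀ u₀ φ Fx Fu) {M M' : (Fin m → ℕ) × (Fin m → ℕ)}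
    (hM : M ∈ spanOrders g Fx Fu (eqY g x₀ u₀ φ))
    (hM' : M' ∈ spanOrders g Fx Fu (eqY g x₀ u₀ φ)) :
    M ⊓ M' ∈ spanOrders g Fx Fu (eqY g x₀ u₀ φ) := by
  filter_upwards [hM, hM', linearIndepOn_sysForm hf hg hflat
    (max (∑ j, M.1 j + ∑ j, M.2 j + 1) (∑ j, M'.1 j + ∑ j, M'.2 j + 1))] with Y h1 h2 h3
  rw [systemSpan_eq] at h1 h2
  rw [systemSpan_eq (M ⊓ M')]
  refine (le_inf h1 h2).trans ((span_image_inf_le (h3.mono ?_)).trans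
    (Submodule.span_mono (Set.image_mono ?_)))
  · refine Set.union_subset (fun i hi => ?_) (fun i hi => ?_)
    · exact lt_of_lt_of_le (show sysOrder i < _ from sysIndices_subset M hi) (le_max_left _ _)
    · exact lt_of_lt_of_le (show sysOrder i < _ from sysIndices_subset M' hi) (le_max_right _ _)
  · rintro (p | i | p) ⟨h4, h5⟩
    · exact le_inf (show p.1 + 1 ≤ M.1 p.2 from h4) (show p.1 + 1 ≤ M'.1 p.2 from h5)
    · trivial
    · exact le_inf (show p.1 ≤ M.2 p.2 from h4) (show p.1 ≤ M'.2 p.2 from h5)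

end Forms

/-! ### Identities on the space of the outputs -/

section Identities

variable {n m : ℕ} {f : (Fin n → ℝ) × (Fin m → ℝ) → Fin n → ℝ}
  {g : (Fin n → ℝ) × (Fin m → ℝ) → Fin m → ℝ}
  {ψ : (Fin n → ℝ) × (Fin m → ℝ) → (Fin n → ℝ) × (Fin m → ℝ)}
  {x₀ : Fin n → ℝ} {u₀ : Fin m → ℝ}
  {Q₁ Q₂ R₁ R₂ : Fin m → ℕ} {φ : OutArg n Q₁ Q₂ → Fin m → ℝ}
  {Fx : (Window (lo R₁) (hiPred R₂) → ℝ) → Fin n → ℝ}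
  {Fu : (Window (lo R₁) (hi R₂) → ℝ) → Fin m → ℝ}

/-- Along trajectories this is the system equation itself; `eventually_of_outputs` removes the
restriction to trajectories. -/
theorem stateMap_shiftY_one (hf : IsSystem f x₀ u₀) (hg : IsExtension f g ψ x₀ u₀)
    (hflat : IsFlatOutput f g ψ x₀ u₀ φ Fx Fu) :
    ∀ᶠ Y in 𝓝 (eqY g x₀ u₀ φ),
      stateMap Fx (shiftY 1 Y) = f (stateMap Fx Y, inputMap Fu Y) := by
  refine eventually_of_outputs hf hg hflat (K := orderBound R₁ R₂ + 1) ?_ ?_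
  · intro Y Y' h hY
    have h0 : AgreeY (orderBound R₁ R₂) Y Y' := h.mono (by omega)
    have h1 : AgreeY (orderBound R₁ R₂) (shiftY 1 Y) (shiftY 1 Y') := AgreeY.shiftY h
    rw [← h0.stateMap (Fx := Fx), ← h0.inputMap (Fu := Fu), ← h1.stateMap (Fx := Fx), hY]
  · filter_upwards [stateMap_shiftY_outputs hf hg hflat 1, hflat.param_x, hflat.param_u]
      with P h1 h2 h3
    have h2' : stateMap Fx (outputs f g ψ φ P) = P.2.1 := h2.symm
    have h3' : inputMap Fu (outputs f g ψ φ P) = P.2.2 0 := h3.symm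
    rw [h1, h2', h3']
    rfl

theorem Agree.mono {N N' : ℕ} {P P' : SysPoint n m} (h : Agree N P P') (hN : N' ≤ N) :
    Agree N' P P' :=
  ⟨fun k hk => h.1 k (hk.trans_le hN), h.2.1, fun k hk => h.2.2 k (hk.trans_le hN)⟩

theorem outputs_sysOfY (hf : IsSystem f x₀ u₀) (hg : IsExtension f g ψ x₀ u₀)
    (hflat : IsFlatOutput f g ψ x₀ u₀ φ Fx Fu) (k : ℤ) :
    ∀ᶠ Y in 𝓝 (eqY g x₀ u₀ φ), outputs f g ψ φ (sysOfY g Fx Fu Y) k = Y k := by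
  obtain ⟨N, hN⟩ := exists_outputs_congr f g ψ φ k
  refine eventually_of_outputs hf hg hflat (K := orderBound R₁ R₂ + N + k.natAbs) ?_ ?_
  · intro Y Y' h hY
    rw [← h k (by omega), ← hY]
    exact (hN _ _ (AgreeY.sysOfY (h.mono (by omega)))).symm
  · filter_upwards [eventually_agree_sysOfY_outputs hf hg hflat N] with P hP
    exact hN _ _ hP

/-- Replaces the coordinates of order at least `N` of `P` by those of `C`. -/
def truncSys (N : ℕ) (C P : SysPoint n m) : SysPoint n m :=
  (fun k => if k < N then P.1 k else C.1 k, P.2.1, fun k => if k < N then P.2.2 k else C.2.2 k)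

theorem agree_truncSys (N : ℕ) (C P : SysPoint n m) : Agree N P (truncSys N C P) :=
  ⟨fun _ hk => (if_pos hk).symm, rfl, fun _ hk => (if_pos hk).symm⟩

theorem truncSys_self (N : ℕ) (C : SysPoint n m) : truncSys N C C = C := by
  simp [truncSys]

theorem sysCoord_truncSys_of_le {N : ℕ} {i : SysIndex n m} (hi : N ≤ sysOrder i)
    (hN : 0 < N) (C P : SysPoint n m) :
    sysCoord n m i (truncSys N C P) = sysCoord n m i C := by
  rcases i with p | i | p
  · exact congrFun (if_neg (not_lt.2 hi)) p.2
  · exact absurd hi (not_le.2 hN)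
  · exact congrFun (if_neg (not_lt.2 hi)) p.2

theorem strictDiffAt_truncSys_sysOfY (hf : IsSystem f x₀ u₀) (hg : IsExtension f g ψ x₀ u₀)
    (hflat : IsFlatOutput f g ψ x₀ u₀ φ Fx Fu) (N : ℕ) (C : SysPoint n m) :
    ∀ᶠ Y in 𝓝 (eqY g x₀ u₀ φ),
      StrictDiffAt (fun Y => truncSys N C (sysOfY g Fx Fu Y)) Y := by
  have h1 : ∀ᶠ Y in 𝓝 (eqY g x₀ u₀ φ), ∀ k ∈ Finset.range N,
      StrictDiffAt (fun Y => (sysOfY g Fx Fu Y).1 k) Y :=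
    (Finset.eventually_all _).2 fun k _ => strictDiffAt_sysOfY_z hf hg hflat k
  have h2 : ∀ᶠ Y in 𝓝 (eqY g x₀ u₀ φ), ∀ k ∈ Finset.range N,
      StrictDiffAt (fun Y => (sysOfY g Fx Fu Y).2.2 k) Y :=
    (Finset.eventually_all _).2 fun k _ => strictDiffAt_sysOfY_u hflat k
  filter_upwards [h1, strictDiffAt_stateMap hflat, h2] with Y h1 hx h2
  refine StrictDiffAt.prodMk (StrictDiffAt.pi fun k => ?_)
    (hx.prodMk (StrictDiffAt.pi fun k => ?_))
  · by_cases hk : k < N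
    · simp only [if_pos hk]
      exact h1 k (Finset.mem_range.2 hk)
    · simp only [if_neg hk]
      exact .const _ _
  · by_cases hk : k < N
    · simp only [if_pos hk]
      exact h2 k (Finset.mem_range.2 hk)
    · simp only [if_neg hk]
      exact .const _ _

theorem eq_zero_of_sysCoord {P : SysPoint n m} (h : ∀ i, sysCoord n m i P = 0) : P = 0 :=
  Prod.ext (funext fun k => funext fun j => h (.inl (k, j)))
    (Prod.ext (funext fun i => h (.inr (.inl i)))
      (funext fun k => funext fun j => h (.inr (.inr (k, j)))))

/-- Differentiating y_[k] = `outputs` ∘ `sysOfY` expresses dy_[k] by the generators. Coordinates of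
order at least `N` are frozen at the equilibrium, as only finitely many are differentiable on a
common neighbourhood. The condition 0 < N keeps x, which has order 0, among the free ones. -/
theorem diffl_coord_mem_span (hf : IsSystem f x₀ u₀) (hg : IsExtension f g ψ x₀ u₀)
    (hflat : IsFlatOutput f g ψ x₀ u₀ φ Fx Fu) (k : ℤ) {N : ℕ} (hN0 : 0 < N)
    (hN : ∀ P P' : SysPoint n m, Agree N P P' → outputs f g ψ φ P k = outputs f g ψ φ P' k) :
    ∀ᶠ Y in 𝓝 (eqY g x₀ u₀ φ), ∀ j, diffl (fun Z => Z k j) Y ∈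
      Submodule.span ℝ (sysForm g Fx Fu Y '' sysIndices n (fun _ => N, fun _ => N)) := by
  set C := eqPoint g x₀ u₀
  have hB : Tendsto (fun Y => truncSys N C (sysOfY g Fx Fu Y)) (𝓝 (eqY g x₀ u₀ φ)) (𝓝 C) := by
    have := (strictDiffAt_truncSys_sysOfY hf hg hflat N C).self_of_nhds.continuousAt
    rwa [ContinuousAt, sysOfY_eqY hf hg hflat, truncSys_self] at this
  filter_upwards [strictDiffAt_truncSys_sysOfY hf hg hflat N C,
    hB.eventually (strictDiffAt_outputs hf hg hflat.smooth_out k),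
    (outputs_sysOfY hf hg hflat k).eventually_nhds] with Y h1 h2 h3 j
  obtain ⟨B, hB⟩ := h1
  obtain ⟨A, hA⟩ := h2
  have hAB : A.comp B = yCoord m k := by
    refine strict_unique (strict_congr (strict_comp hA hB) ?_) (strict_clm (yCoord m k) Y)
    filter_upwards [h3] with Z hZ
    exact (hN _ _ (agree_truncSys N C _)).symm.trans hZ
  have hBi : ∀ i, HasStrictFDerivAt
      (fun Z => sysCoord n m i (truncSys N C (sysOfY g Fx Fu Z))) ((sysCoord n m i).comp B) Y :=
    fun i => strict_comp (strict_clm (sysCoord n m i) _) hB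
  have hlt : ∀ i, sysOrder i < N →
      sysForm g Fx Fu Y i = coeffs m ((sysCoord n m i).comp B).toLinearMap := by
    intro i hi
    refine diffl_eq_coeffs (strict_congr (hBi i) (.of_forall fun Z => ?_))
    exact ((agree_truncSys N C _).sysCoord hi).symm
  have hge : ∀ i, N ≤ sysOrder i → (sysCoord n m i).comp B = 0 := by
    intro i hi
    refine strict_unique (strict_congr (hBi i) (.of_forall fun Z => ?_))
      (strict_const (sysCoord n m i C) Y)
    exact sysCoord_truncSys_of_le hi hN0 C _
  let yj : YPoint m →L[ℝ] ℝ :=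
    (ContinuousLinearMap.proj (R := ℝ) (φ := fun _ : Fin m => ℝ) j).comp (yCoord m k)
  have hfin : Finite {i : SysIndex n m | sysOrder i < N} := finite_sysOrder_lt N
  have hmem : yj.toLinearMap ∈ Submodule.span ℝ (Set.range
      fun i : {i : SysIndex n m | sysOrder i < N} => ((sysCoord n m i).comp B).toLinearMap) := by
    -- A form vanishing on the common kernel of finitely many forms lies in their span, and the
    -- factorization `A.comp B` shows that dy^j_[k] vanishes there.
    refine mem_span_of_iInf_ker_le_ker fun w hw => ?_
    have hBw : B w = 0 := eq_zero_of_sysCoord fun i => by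
      by_cases hi : sysOrder i < N
      · exact (Submodule.mem_iInf _).1 hw ⟨i, hi⟩
      · exact congrArg (fun L => L w) (hge i (not_lt.1 hi))
    have h4 : A (B w) j = w k j := congrArg (fun L => L w j) hAB
    rw [hBw, map_zero] at h4
    exact h4.symm
  have hmem' := Submodule.mem_map_of_mem (f := coeffs m) hmem
  rw [Submodule.map_span] at hmem'
  rw [show diffl (fun Z : YPoint m => Z k j) Y = coeffs m yj.toLinearMap from
    diffl_eq_coeffs (strict_clm yj Y)]
  refine Submodule.span_mono ?_ hmem'
  rintro _ ⟨_, ⟨⟨i, hi⟩, rfl⟩, rfl⟩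
  refine ⟨i, ?_, hlt i hi⟩
  rcases i with p | i | p
  · exact hi
  · trivial
  · exact le_of_lt (show p.1 < N from hi)

theorem spanOrders_nonempty (hf : IsSystem f x₀ u₀) (hg : IsExtension f g ψ x₀ u₀)
    (hflat : IsFlatOutput f g ψ x₀ u₀ φ Fx Fu) :
    (spanOrders g Fx Fu (eqY g x₀ u₀ φ)).Nonempty := by
  choose N hN using exists_outputs_congr f g ψ φ
  set I := Finset.Icc (-(orderBound R₁ R₂ : ℤ)) (orderBound R₁ R₂)
  set S := ∑ k ∈ I, N k + 1 with hS
  have h : ∀ᶠ Y in 𝓝 (eqY g x₀ u₀ φ), ∀ k ∈ I, ∀ j, diffl (fun Z => Z k j) Y ∈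
      Submodule.span ℝ (sysForm g Fx Fu Y '' sysIndices n (fun _ => S, fun _ => S)) := by
    refine (Finset.eventually_all _).2 fun k hk => ?_
    refine diffl_coord_mem_span hf hg hflat k (by omega) fun P P' hP => hN k P P' (hP.mono ?_)
    have := Finset.single_le_sum (f := N) (fun _ _ => Nat.zero_le _) hk
    omega
  refine ⟨(fun _ => S, fun _ => S), ?_⟩
  filter_upwards [h] with Y hY
  rw [systemSpan_eq (fun _ => S, fun _ => S), outputSpan, Submodule.span_le]
  rintro _ ⟨j, k, h1, h2, rfl⟩
  have := natAbs_le_orderBound h1 h2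
  exact hY k (Finset.mem_Icc.2 (by omega)) j

theorem exists_isLeast_spanOrders (hf : IsSystem f x₀ u₀) (hg : IsExtension f g ψ x₀ u₀)
    (hflat : IsFlatOutput f g ψ x₀ u₀ φ Fx Fu) :
    ∃ M, IsLeast (spanOrders g Fx Fu (eqY g x₀ u₀ φ)) M :=
  exists_isLeast_of_inf_mem (spanOrders_nonempty hf hg hflat)
    fun _ hM _ hM' => inf_mem_spanOrders hf hg hflat hM hM'

end Identities

/-! ### Linear algebra for the rank conditions -/

theorem rank_eq_iff_mulVec_injective {n m : ℕ} (A : Matrix (Fin n) (Fin m) ℝ) :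
    A.rank = m ↔ ∀ v, A.mulVec v = 0 → v = 0 := by
  have h := LinearMap.finrank_range_add_finrank_ker A.mulVecLin
  rw [Module.finrank_fin_fun] at h
  have h1 : (∀ v, A.mulVec v = 0 → v = 0) ↔ LinearMap.ker A.mulVecLin = ⊥ := by
    rw [LinearMap.ker_eq_bot']
    rfl
  rw [h1, ← Submodule.finrank_eq_zero (R := ℝ), Matrix.rank]
  omega

theorem vecMul_injective_of_mulVec_injective {m : ℕ} {A : Matrix (Fin m) (Fin m) ℝ}
    (h : ∀ v, A.mulVec v = 0 → v = 0) {c : Fin m → ℝ} (hc : Matrix.vecMul c A = 0) : c = 0 := by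
  by_contra hne
  have hdet := Matrix.exists_vecMul_eq_zero_iff.1 ⟨c, hne, hc⟩
  obtain ⟨v, hv, hv0⟩ := Matrix.exists_mulVec_eq_zero_iff.2 hdet
  exact hv (h v hv0)

/-- If the vectors `e k i` are in block-triangular position with respect to the maps `T k`, which
vanish on `W`, a vector of `W ⊔ span e` that is killed by all `T k` belongs to `W`. -/
theorem mem_of_triangular {V : Type*} [AddCommGroup V] [Module ℝ V] {m : ℕ}
    {W : Submodule ℝ V} {e : ℕ → Fin m → V} {T : ℕ → V →ₗ[ℝ] (Fin m → ℝ)}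
    (hW : ∀ K, ∀ w ∈ W, T K w = 0) (hlow : ∀ K k i, k < K → T K (e k i) = 0) {N : ℕ}
    (hnd : ∀ K < N, ∀ c : Fin m → ℝ, ∑ i, c i • T K (e K i) = 0 → c = 0) {η : V}
    (hT : ∀ K < N, T K η = 0)
    (hη : η ∈ W ⊔ Submodule.span ℝ {x | ∃ k < N, ∃ i, x = e k i}) : η ∈ W := by
  induction N with
  | zero => simpa using hη
  | succ N ih =>
    refine ih (fun K hK => hnd K (by omega)) (fun K hK => hT K (by omega)) ?_
    set W' := W ⊔ Submodule.span ℝ {x | ∃ k < N, ∃ i, x = e k i} with hW'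
    have hle : W ⊔ Submodule.span ℝ {x | ∃ k < N + 1, ∃ i, x = e k i} ≤
        W' ⊔ Submodule.span ℝ (Set.range (e N)) := by
      refine sup_le (le_sup_left.trans le_sup_left) (Submodule.span_le.2 ?_)
      rintro _ ⟨k, hk, i, rfl⟩
      rcases Nat.lt_succ_iff_lt_or_eq.1 hk with hk | rfl
      · exact Submodule.mem_sup_left (Submodule.mem_sup_right
          (Submodule.subset_span ⟨k, hk, i, rfl⟩))
      · exact Submodule.mem_sup_right (Submodule.subset_span ⟨i, rfl⟩)
    obtain ⟨a, ha, b, hb, rfl⟩ := Submodule.mem_sup.1 (hle hη)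
    obtain ⟨c, rfl⟩ := (Submodule.mem_span_range_iff_exists_fun ℝ).1 hb
    have hTW' : W' ≤ LinearMap.ker (T N) := by
      refine sup_le (fun w hw => hW N w hw) (Submodule.span_le.2 ?_)
      rintro _ ⟨k, hk, i, rfl⟩
      exact hlow N k i hk
    -- `T N` kills `W` and all layers below `N`, so it sees only the top layer, whose coefficients
    -- `c` must vanish.
    have h1 := hT N (by omega)
    rw [map_add, LinearMap.mem_ker.1 (hTW' ha), zero_add, map_sum] at h1
    simp only [map_smul] at h1
    rw [hnd N (by omega) c h1]
    simpa using ha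

/-! ### Coefficients of shifted forms -/

section Shifted

variable {m : ℕ}

theorem shiftY_add_unitY (s : ℤ) (Y : YPoint m) (t : ℝ) (k : ℤ) (j : Fin m) :
    shiftY s (Y + t • unitY (k, j)) = shiftY s Y + t • unitY (k - s, j) := by
  funext i l
  have : i + s = k ↔ i = k - s := by omega
  simp [shiftY, unitY, Pi.single_apply, this]

/-- No differentiability is needed: both sides are derivatives of the same function of t. -/
theorem diffl_shiftY (h : YPoint m → ℝ) (s : ℤ) (Y : YPoint m) (k : ℤ) (j : Fin m) :
    diffl (fun Z => h (shiftY s Z)) Y (k, j) = diffl h (shiftY s Y) (k - s, j) := by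
  have := fun t => shiftY_add_unitY s Y t k j
  simp only [unitY] at this
  simp only [diffl, lineDeriv, this]

theorem window_add_unitY {a b : Fin m → ℤ} {k : ℤ} {j : Fin m} (hk : k < a j ∨ b j < k)
    (Y : YPoint m) (t : ℝ) : window a b (Y + t • unitY (k, j)) = window a b Y := by
  funext w
  obtain ⟨h1, h2⟩ := Finset.mem_Icc.1 w.2.2
  by_cases hw : w.1 = j
  · have : (w.2 : ℤ) ≠ k := by
      subst hw
      omega
    simp [window, unitY, this]
  · by_cases hk' : (w.2 : ℤ) = k
    · simp [window, unitY, hk', hw]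
    · simp [window, unitY, hk']

theorem diffl_window_eq_zero {a b : Fin m → ℤ} {h : (Window a b → ℝ) → ℝ} {k : ℤ} {j : Fin m}
    (hk : k < a j ∨ b j < k) (Y : YPoint m) :
    diffl (fun Z => h (window a b Z)) Y (k, j) = 0 :=
  lineDeriv_congr_of_eq fun t => congrArg h (window_add_unitY hk Y t)

theorem diffl_coord (k : ℤ) (j : Fin m) (Y : YPoint m) (p : ℤ × Fin m) :
    diffl (fun Z => Z k j) Y p = if p = (k, j) then 1 else 0 := by
  have := lineDeriv_eq_of_strict (strict_clm ((ContinuousLinearMap.proj (R := ℝ)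
    (φ := fun _ : Fin m => ℝ) j).comp (yCoord m k)) Y) (unitY p)
  refine (Eq.trans this ?_ : lineDeriv ℝ (fun Z : YPoint m => Z k j) Y (unitY p) = _)
  change (unitY p) k j = _
  by_cases h1 : k = p.1
  · subst h1
    simp [unitY, Pi.single_apply, Prod.ext_iff, eq_comm]
  · simp [unitY, Prod.ext_iff, h1, Ne.symm h1]

/-- The pairing of a form with the tangent vector `∑ v_j ∂/∂y^j_[q_j]`. -/
noncomputable def pairing (q : Fin m → ℤ) (v : Fin m → ℝ) : (ℤ × Fin m → ℝ) →ₗ[ℝ] ℝ :=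
  ∑ j, v j • LinearMap.proj (q j, j)

theorem pairing_apply (q : Fin m → ℤ) (v : Fin m → ℝ) (η : ℤ × Fin m → ℝ) :
    pairing q v η = ∑ j, η (q j, j) * v j := by
  simp [pairing, mul_comm]

/-- Pairing dy^j_[q_j] with the tangent vector returns v_j, and these forms lie in `W`. -/
theorem eq_zero_of_pairing {R₁ R₂ : Fin m → ℕ} {q : Fin m → ℤ} (hq1 : ∀ j, lo R₁ j ≤ q j)
    (hq2 : ∀ j, q j ≤ hi R₂ j) {v : Fin m → ℝ} {Y : YPoint m} {W : Submodule ℝ (ℤ × Fin m → ℝ)}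
    (hW : outputSpan R₁ R₂ Y ≤ W) (hv : W ≤ LinearMap.ker (pairing q v)) : v = 0 := by
  funext j
  have h : diffl (fun Z => Z (q j) j) Y ∈ outputSpan R₁ R₂ Y :=
    Submodule.subset_span ⟨j, q j, hq1 j, hq2 j, rfl⟩
  have h1 : pairing q v _ = 0 := hv (hW h)
  rw [pairing_apply, Finset.sum_eq_single j] at h1
  · simpa [diffl_coord] using h1
  · intro l _ hl
    simp [diffl_coord, hl]
  · simp

/-- The coefficients of a form at the `dy^j_[q_j]`. -/
def coeffsAt (q : Fin m → ℤ) : (ℤ × Fin m → ℝ) →ₗ[ℝ] (Fin m → ℝ) :=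
  LinearMap.pi fun j => LinearMap.proj (q j, j)

theorem coeffsAt_apply (q : Fin m → ℤ) (η : ℤ × Fin m → ℝ) (j : Fin m) :
    coeffsAt q η j = η (q j, j) := rfl

theorem coeffsAt_eq_zero_of_mem_outputSpan {R₁ R₂ : Fin m → ℕ} {q : Fin m → ℤ}
    (hq : ∀ j, q j < lo R₁ j ∨ hi R₂ j < q j) {Y : YPoint m} {η : ℤ × Fin m → ℝ}
    (hη : η ∈ outputSpan R₁ R₂ Y) : coeffsAt q η = 0 := by
  have : outputSpan R₁ R₂ Y ≤ LinearMap.ker (coeffsAt q) := by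
    refine Submodule.span_le.2 ?_
    rintro _ ⟨j, k, h1, h2, rfl⟩
    refine funext fun l => ?_
    rw [coeffsAt_apply, diffl_coord]
    refine if_neg fun h => ?_
    obtain ⟨h3, rfl⟩ := Prod.ext_iff.1 h
    rcases hq l with h4 | h4 <;> simp only at h1 h2 h3 <;> omega
  exact this hη

end Shifted

/-! ### The generating forms at the extreme orders -/

section Extreme

variable {n m : ℕ} {g : (Fin n → ℝ) × (Fin m → ℝ) → Fin m → ℝ} {R₁ R₂ : Fin m → ℕ}
  {Fx : (Window (lo R₁) (hiPred R₂) → ℝ) → Fin n → ℝ}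
  {Fu : (Window (lo R₁) (hi R₂) → ℝ) → Fin m → ℝ}

theorem diffl_stateMap_eq_zero (i : Fin n) (Y : YPoint m) {k : ℤ} {j : Fin m}
    (hk : k < lo R₁ j ∨ hi R₂ j - 1 < k) :
    diffl (fun Z => stateMap Fx Z i) Y (k, j) = 0 :=
  diffl_window_eq_zero (a := lo R₁) (b := hiPred R₂) (h := fun w => Fx w i) hk Y

theorem diffl_inputMap_eq_zero (i : Fin m) (s : ℤ) (Y : YPoint m) {k : ℤ} {j : Fin m}
    (hk : k - s < lo R₁ j ∨ hi R₂ j < k - s) :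
    diffl (fun Z => inputMap Fu (shiftY s Z) i) Y (k, j) = 0 := by
  rw [diffl_shiftY (fun Z => inputMap Fu Z i)]
  exact diffl_window_eq_zero (a := lo R₁) (b := hi R₂) (h := fun w => Fu w i) hk _

theorem stateMap_add_unitY {k : ℤ} {j : Fin m} (hk : k < lo R₁ j ∨ hi R₂ j - 1 < k)
    (Y : YPoint m) (t : ℝ) : stateMap Fx (Y + t • unitY (k, j)) = stateMap Fx Y :=
  congrArg Fx (window_add_unitY (a := lo R₁) (b := hiPred R₂) hk Y t)

theorem diffl_zeta_eq_zero (i : Fin m) (s : ℤ) (Y : YPoint m) {k : ℤ} {j : Fin m}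
    (hk : k - s < lo R₁ j ∨ hi R₂ j < k - s) :
    diffl (fun Z => g (stateMap Fx (shiftY s Z), inputMap Fu (shiftY s Z)) i) Y (k, j) = 0 := by
  rw [diffl_shiftY (fun Z => g (stateMap Fx Z, inputMap Fu Z) i)]
  refine lineDeriv_congr_of_eq fun t => ?_
  have h1 : stateMap Fx (shiftY s Y + t • unitY (k - s, j)) = stateMap Fx (shiftY s Y) :=
    stateMap_add_unitY (by omega) _ _
  have h2 : inputMap Fu (shiftY s Y + t • unitY (k - s, j)) = inputMap Fu (shiftY s Y) :=
    congrArg Fu (window_add_unitY hk _ _)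
  exact congrArg₂ (fun a b => g (a, b) i) h1 h2

/-- Each M₂ j is at most the sum of all of them, so complete layers of m forms up to that bound
suffice. Elimination needs complete layers because it uses a square block. -/
theorem systemSpan_le_sup_input (M₁ M₂ : Fin m → ℕ) (Y : YPoint m) :
    systemSpan g Fx Fu M₁ M₂ Y ≤ systemSpan g Fx Fu M₁ 0 Y ⊔
      Submodule.span ℝ {η | ∃ k < ∑ j, M₂ j, ∃ i,
        η = diffl (fun Z => inputMap Fu (shiftY ((k + 1 : ℕ) : ℤ) Z) i) Y} := by
  refine Submodule.span_le.2 ?_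
  rintro _ ((⟨j, k, h1, h2, rfl⟩ | ⟨i, rfl⟩) | ⟨j, k, h, rfl⟩)
  · exact Submodule.mem_sup_left (Submodule.subset_span (.inl (.inl ⟨j, k, h1, h2, rfl⟩)))
  · exact Submodule.mem_sup_left (Submodule.subset_span (.inl (.inr ⟨i, rfl⟩)))
  · cases k with
    | zero => exact Submodule.mem_sup_left (Submodule.subset_span (.inr ⟨j, 0, le_rfl, rfl⟩))
    | succ k =>
      have := Finset.single_le_sum (f := M₂) (fun _ _ => Nat.zero_le _) (Finset.mem_univ j)
      exact Submodule.mem_sup_right (Submodule.subset_span ⟨k, by omega, j, rfl⟩)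

theorem systemSpan_le_sup_zeta (M₁ M₂ : Fin m → ℕ) (Y : YPoint m) :
    systemSpan g Fx Fu M₁ M₂ Y ≤ systemSpan g Fx Fu 0 M₂ Y ⊔
      Submodule.span ℝ {η | ∃ k < ∑ j, M₁ j, ∃ i,
        η = diffl (fun Z => g (stateMap Fx (shiftY (-((k + 1 : ℕ) : ℤ)) Z),
          inputMap Fu (shiftY (-((k + 1 : ℕ) : ℤ)) Z)) i) Y} := by
  refine Submodule.span_le.2 ?_
  rintro _ ((⟨j, k, h1, h2, rfl⟩ | ⟨i, rfl⟩) | ⟨j, k, h, rfl⟩)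
  · obtain ⟨k, rfl⟩ := Nat.exists_eq_add_of_le' h1
    have := Finset.single_le_sum (f := M₁) (fun _ _ => Nat.zero_le _) (Finset.mem_univ j)
    exact Submodule.mem_sup_right (Submodule.subset_span ⟨k, by omega, j, rfl⟩)
  · exact Submodule.mem_sup_left (Submodule.subset_span (.inl (.inr ⟨i, rfl⟩)))
  · exact Submodule.mem_sup_left (Submodule.subset_span (.inr ⟨j, k, h, rfl⟩))

/-- At the order R₂, dF_x and the backward-shifted forms have zero coefficients, and a kernel vector
of the block annihilates dF_u. -/
theorem topBlock_rank_of_le {M₁ : Fin m → ℕ} {Y : YPoint m}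
    (h : outputSpan R₁ R₂ Y ≤ systemSpan g Fx Fu M₁ 0 Y) : (topBlock Fu Y).rank = m := by
  rw [rank_eq_iff_mulVec_injective]
  intro v hv
  refine eq_zero_of_pairing (q := hi R₂) (fun j => by simp only [lo, hi]; omega)
    (fun j => le_rfl) h (Submodule.span_le.2 ?_)
  rintro _ ((⟨j, k, h1, h2, rfl⟩ | ⟨i, rfl⟩) | ⟨i, k, hk, rfl⟩) <;>
    rw [SetLike.mem_coe, LinearMap.mem_ker, pairing_apply]
  · exact Finset.sum_eq_zero fun l _ => by rw [diffl_zeta_eq_zero _ _ _ (by omega), zero_mul]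
  · exact Finset.sum_eq_zero fun l _ => by rw [diffl_stateMap_eq_zero _ _ (by omega), zero_mul]
  · obtain rfl : k = 0 := Nat.le_zero.1 hk
    simp only [Nat.cast_zero, shiftY_zero]
    exact congrFun hv i

/-- Elimination from the highest order down: at R₂+K+1 the only contribution up to layer `K` comes
from layer `K`, with the top block at the shifted point as coefficients, whereas the forms
dy_[-R₁,R₂] have no such component. -/
theorem le_systemSpan_of_topBlock_rank {M₁ M₂ : Fin m → ℕ} {Y : YPoint m}
    (hr : ∀ k < ∑ j, M₂ j, (topBlock Fu (shiftY ((k + 1 : ℕ) : ℤ) Y)).rank = m)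
    (h : outputSpan R₁ R₂ Y ≤ systemSpan g Fx Fu M₁ M₂ Y) :
    outputSpan R₁ R₂ Y ≤ systemSpan g Fx Fu M₁ 0 Y := by
  intro η hη
  refine mem_of_triangular
    (e := fun k i => diffl (fun Z => inputMap Fu (shiftY ((k + 1 : ℕ) : ℤ) Z) i) Y)
    (T := fun K => coeffsAt fun l => hi R₂ l + (K + 1 : ℕ)) (N := ∑ j, M₂ j)
    ?_ ?_ ?_ ?_ (systemSpan_le_sup_input M₁ M₂ Y (h hη))
  · intro K w hw
    have hle : systemSpan g Fx Fu M₁ 0 Y ≤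
        LinearMap.ker (coeffsAt fun l => hi R₂ l + (K + 1 : ℕ)) := by
      refine Submodule.span_le.2 ?_
      rintro _ ((⟨j, k, h1, h2, rfl⟩ | ⟨i, rfl⟩) | ⟨i, k, hk, rfl⟩) <;>
        refine funext fun l => ?_ <;> rw [coeffsAt_apply]
      · exact diffl_zeta_eq_zero _ _ _ (by omega)
      · exact diffl_stateMap_eq_zero _ _ (by omega)
      · obtain rfl : k = 0 := Nat.le_zero.1 hk
        exact diffl_inputMap_eq_zero _ _ _ (by omega)
    exact hle hw
  · intro K k i hk
    exact funext fun l => diffl_inputMap_eq_zero _ _ _ (by dsimp only; omega)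
  · intro K hK c hc
    refine vecMul_injective_of_mulVec_injective ((rank_eq_iff_mulVec_injective _).1 (hr K hK)) ?_
    rw [← hc]
    funext l
    rw [Finset.sum_apply, Matrix.vecMul, dotProduct]
    refine Finset.sum_congr rfl fun i _ => ?_
    rw [Pi.smul_apply, coeffsAt_apply, diffl_shiftY (fun Z => inputMap Fu Z i),
      add_sub_cancel_right]
    rfl
  · intro K _
    exact coeffsAt_eq_zero_of_mem_outputSpan (fun j => .inr (by omega)) hη

/-- Mirror image at the orders -R₁-K-1; the diagonal blocks are now those of g(F_x,F_u) with respect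
to y_[-R₁]. -/
theorem le_systemSpan_of_zeta_injective {M₁ M₂ : Fin m → ℕ} {Y : YPoint m}
    (hr : ∀ k < ∑ j, M₁ j, ∀ v : Fin m → ℝ,
      (∀ i, pairing (lo R₁) v (diffl (fun Z => g (stateMap Fx Z, inputMap Fu Z) i)
        (shiftY (-((k + 1 : ℕ) : ℤ)) Y)) = 0) → v = 0)
    (h : outputSpan R₁ R₂ Y ≤ systemSpan g Fx Fu M₁ M₂ Y) :
    outputSpan R₁ R₂ Y ≤ systemSpan g Fx Fu 0 M₂ Y := by
  intro η hη
  refine mem_of_triangular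
    (e := fun k i => diffl (fun Z => g (stateMap Fx (shiftY (-((k + 1 : ℕ) : ℤ)) Z),
          inputMap Fu (shiftY (-((k + 1 : ℕ) : ℤ)) Z)) i) Y)
    (T := fun K => coeffsAt fun l => lo R₁ l + -((K + 1 : ℕ) : ℤ)) (N := ∑ j, M₁ j)
    ?_ ?_ ?_ ?_ (systemSpan_le_sup_zeta M₁ M₂ Y (h hη))
  · intro K w hw
    have hle : systemSpan g Fx Fu 0 M₂ Y ≤
        LinearMap.ker (coeffsAt fun l => lo R₁ l + -((K + 1 : ℕ) : ℤ)) := by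
      refine Submodule.span_le.2 ?_
      rintro _ ((⟨j, k, h1, h2, rfl⟩ | ⟨i, rfl⟩) | ⟨i, k, hk, rfl⟩) <;>
        refine funext fun l => ?_ <;> rw [coeffsAt_apply]
      · have : k ≤ 0 := h2
        omega
      · exact diffl_stateMap_eq_zero _ _ (by omega)
      · exact diffl_inputMap_eq_zero _ _ _ (by omega)
    exact hle hw
  · intro K k i hk
    exact funext fun l => diffl_zeta_eq_zero _ _ _ (by dsimp only; omega)
  · intro K hK c hc
    refine vecMul_injective_of_mulVec_injective (A := Matrix.of fun i l =>
      diffl (fun Z => g (stateMap Fx Z, inputMap Fu Z) i)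
        (shiftY (-((K + 1 : ℕ) : ℤ)) Y) (lo R₁ l, l)) (fun v hv => hr K hK v fun i => ?_) ?_
    · rw [pairing_apply]
      exact congrFun hv i
    · rw [← hc]
      funext l
      rw [Finset.sum_apply, Matrix.vecMul, dotProduct]
      refine Finset.sum_congr rfl fun i _ => ?_
      rw [Pi.smul_apply, coeffsAt_apply,
        diffl_shiftY (fun Z => g (stateMap Fx Z, inputMap Fu Z) i), add_sub_cancel_right]
      rfl
  · intro K _
    exact coeffsAt_eq_zero_of_mem_outputSpan (fun j => .inl (by omega)) hη

/-- With no backward forms present, only dF_x and dF_u can reach the order -R₁. A kernel vector of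
the block kills the former, and `hinj` says that it then kills the latter. -/
theorem bottomBlock_rank_of_le {M₂ : Fin m → ℕ} {Y : YPoint m}
    (hinj : ∀ v, (bottomBlock Fx Y).mulVec v = 0 →
      ∀ i, pairing (lo R₁) v (diffl (fun Z => inputMap Fu Z i) Y) = 0)
    (h : outputSpan R₁ R₂ Y ≤ systemSpan g Fx Fu 0 M₂ Y) : (bottomBlock Fx Y).rank = m := by
  rw [rank_eq_iff_mulVec_injective]
  intro v hv
  refine eq_zero_of_pairing (q := lo R₁) (fun j => le_rfl)
    (fun j => by simp only [lo, hi]; omega) h (Submodule.span_le.2 ?_)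
  rintro _ ((⟨j, k, h1, h2, rfl⟩ | ⟨i, rfl⟩) | ⟨i, k, hk, rfl⟩) <;>
    rw [SetLike.mem_coe, LinearMap.mem_ker]
  · have : k ≤ 0 := h2
    omega
  · rw [pairing_apply]
    exact congrFun hv i
  · cases k with
    | zero =>
      simp only [Nat.cast_zero, shiftY_zero]
      exact hinj v hv i
    | succ k =>
      rw [pairing_apply]
      exact Finset.sum_eq_zero fun l _ => by
        rw [diffl_inputMap_eq_zero _ _ _ (by omega), zero_mul]

end Extreme

/-! ### The differentials of the system equations -/

section Equations

variable {n m : ℕ} {f : (Fin n → ℝ) × (Fin m → ℝ) → Fin n → ℝ}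
  {g : (Fin n → ℝ) × (Fin m → ℝ) → Fin m → ℝ}
  {ψ : (Fin n → ℝ) × (Fin m → ℝ) → (Fin n → ℝ) × (Fin m → ℝ)}
  {x₀ : Fin n → ℝ} {u₀ : Fin m → ℝ}
  {Q₁ Q₂ R₁ R₂ : Fin m → ℕ} {φ : OutArg n Q₁ Q₂ → Fin m → ℝ}
  {Fx : (Window (lo R₁) (hiPred R₂) → ℝ) → Fin n → ℝ}
  {Fu : (Window (lo R₁) (hi R₂) → ℝ) → Fin m → ℝ}

theorem eventually_fderiv_inr_injective (hf : IsSystem f x₀ u₀) :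
    ∀ᶠ q in 𝓝 (x₀, u₀), Function.Injective
      ((fderiv ℝ f q).comp (ContinuousLinearMap.inr ℝ (Fin n → ℝ) (Fin m → ℝ))) := by
  have hsm : ContDiffAt ℝ ∞ f (x₀, u₀) := hf.smooth.self_of_nhds
  have hcont : ContinuousAt (fun q => (fderiv ℝ f q).comp
      (ContinuousLinearMap.inr ℝ (Fin n → ℝ) (Fin m → ℝ))) (x₀, u₀) := by
    have h1 : ContinuousAt (fderiv ℝ f) (x₀, u₀) :=
      (hsm.fderiv_right (m := 0) (by simp)).continuousAt
    exact h1.clm_comp continuousAt_const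
  have h0 : Function.Injective ((fderiv ℝ f (x₀, u₀)).comp
      (ContinuousLinearMap.inr ℝ (Fin n → ℝ) (Fin m → ℝ))) := by
    have hd : HasFDerivAt f (fderiv ℝ f (x₀, u₀)) (x₀, u₀) :=
      (hsm.differentiableAt (by simp)).hasFDerivAt
    have h2 : fderiv ℝ (fun u => f (x₀, u)) u₀ = (fderiv ℝ f (x₀, u₀)).comp
        (ContinuousLinearMap.inr ℝ (Fin n → ℝ) (Fin m → ℝ)) :=
      (hd.comp u₀ (hasFDerivAt_prodMk_right x₀ u₀)).fderiv
    have h3 := hf.independent_inputs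
    rw [h2] at h3
    have h4 := LinearMap.finrank_range_add_finrank_ker ((fderiv ℝ f (x₀, u₀)).comp
      (ContinuousLinearMap.inr ℝ (Fin n → ℝ) (Fin m → ℝ))).toLinearMap
    rw [h3, Module.finrank_fin_fun] at h4
    exact LinearMap.ker_eq_bot.1 (Submodule.finrank_eq_zero.1 (by omega))
  exact hcont.eventually (ContinuousLinearMap.isOpen_injective.mem_nhds h0)

/-- Differentiating ψ ∘ (f,g) = id gives a left inverse of the derivative of (f,g). -/
theorem eventually_fderiv_prod_injective (hf : IsSystem f x₀ u₀)
    (hg : IsExtension f g ψ x₀ u₀) :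
    ∀ᶠ q in 𝓝 (x₀, u₀), ∀ p, fderiv ℝ f q p = 0 → fderiv ℝ g q p = 0 → p = 0 := by
  have ht : Tendsto (fun q => (f q, g q)) (𝓝 (x₀, u₀)) (𝓝 (x₀, g (x₀, u₀))) := by
    have := (hf.smooth.strictDiffAt.self_of_nhds.prodMk
      hg.smooth.strictDiffAt.self_of_nhds).continuousAt
    rwa [ContinuousAt, hf.equilibrium] at this
  filter_upwards [hf.smooth.eventually_strict, hg.smooth.eventually_strict,
    ht.eventually hg.smooth_inv.eventually_strict, hg.left_inv.eventually_nhds]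
    with q h1 h2 h3 h4 p hp1 hp2
  have h5 := strict_unique
    (strict_congr (strict_comp (g := ψ) (f := fun p => (f p, g p)) h3
      (strict_prodMk h1 h2)) h4) (strict_clm (.id ℝ _) q)
  have h6 := congrArg (fun L => L p) h5
  simp only [ContinuousLinearMap.comp_apply, ContinuousLinearMap.prod_apply, hp1, hp2,
    ContinuousLinearMap.id_apply] at h6
  rw [← h6]
  exact map_zero _

/-- Relations between the derivatives of the parameterizing map along the vectors
`∑ v_j ∂/∂y^j_[-r_{1,j}]`. -/
theorem eventually_lowest_relations (hf : IsSystem f x₀ u₀) (hg : IsExtension f g ψ x₀ u₀)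
    (hflat : IsFlatOutput f g ψ x₀ u₀ φ Fx Fu) :
    ∀ᶠ Y in 𝓝 (eqY g x₀ u₀ φ), ∀ v,
      ((bottomBlock Fx Y).mulVec v = 0 →
        ∀ i, pairing (lo R₁) v (diffl (fun Z => inputMap Fu Z i) Y) = 0) ∧
      ((∀ i, pairing (lo R₁) v (diffl (fun Z => g (stateMap Fx Z, inputMap Fu Z) i) Y) = 0) →
        (bottomBlock Fx Y).mulVec v = 0) := by
  have ht := tendsto_stateMap_inputMap hf hg hflat
  filter_upwards [strictDiffAt_stateMap hflat, strictDiffAt_inputMap hflat,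
    ht.eventually hf.smooth.eventually_strict, ht.eventually hg.smooth.eventually_strict,
    ht.eventually (eventually_fderiv_inr_injective hf),
    ht.eventually (eventually_fderiv_prod_injective hf hg),
    (stateMap_shiftY_one hf hg hflat).eventually_nhds] with Y ⟨A, hA⟩ ⟨B, hB⟩ hF hG hinr hinj hI v
  set q := (stateMap Fx Y, inputMap Fu Y)
  set w : YPoint m := ∑ j, v j • unitY (lo R₁ j, j) with hw
  have hpair : ∀ {N : ℕ} {h : YPoint m → Fin N → ℝ} {L : YPoint m →L[ℝ] (Fin N → ℝ)}
      (_ : HasStrictFDerivAt h L Y) (i : Fin N),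
      pairing (lo R₁) v (diffl (fun Z => h Z i) Y) = L w i := by
    intro N h L hL i
    have hLi := strict_comp (strict_clm (ContinuousLinearMap.proj (R := ℝ)
      (φ := fun _ : Fin N => ℝ) i) _) hL
    have hd : diffl (fun Z => h Z i) Y = _ := diffl_eq_coeffs hLi
    rw [hd, pairing_apply, hw, map_sum, Finset.sum_apply]
    refine Finset.sum_congr rfl fun j _ => ?_
    rw [map_smul, Pi.smul_apply, smul_eq_mul, mul_comm]
    rfl
  have hbot : (bottomBlock Fx Y).mulVec v = A w := funext fun i => by
    rw [← hpair hA i, pairing_apply]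
    rfl
  have hAB := strict_prodMk hA hB
  have hFAB : HasStrictFDerivAt (fun Z => stateMap Fx (shiftY 1 Z))
      ((fderiv ℝ f q).comp (A.prod B)) Y := by
    refine strict_congr (strict_comp (g := f) hF hAB) ?_
    filter_upwards [hI] with Z hZ using hZ.symm
  have hGAB : HasStrictFDerivAt (fun Z => g (stateMap Fx Z, inputMap Fu Z))
      ((fderiv ℝ g q).comp (A.prod B)) Y := strict_comp (g := g) hG hAB
  -- f(F_x,F_u) equals the forward shift of F_x, whose window starts at -R₁+1, so its derivative
  -- along `w` vanishes.
  have hrel : fderiv ℝ f q (A w, B w) = 0 := by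
    change ((fderiv ℝ f q).comp (A.prod B)) w = 0
    rw [hw, map_sum]
    refine Finset.sum_eq_zero fun j _ => ?_
    rw [map_smul, ← lineDeriv_eq_of_strict hFAB, lineDeriv_congr_of_eq, smul_zero]
    intro t
    rw [shiftY_add_unitY]
    exact stateMap_add_unitY (.inl (by omega)) _ _
  refine ⟨fun hv i => ?_, fun hv => ?_⟩
  · rw [hbot] at hv
    rw [hv] at hrel
    -- With the state part zero, the relation reduces to ∂_u f · B w = 0, and ∂_u f is injective.
    have h1 : B w = 0 := hinr (by rw [map_zero]; exact hrel)
    rw [hpair hB, h1]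
    rfl
  · have h1 : fderiv ℝ g q (A w, B w) = 0 := funext fun i => by
      have h2 := hv i
      rw [hpair hGAB] at h2
      exact h2
    rw [hbot]
    exact (Prod.ext_iff.1 (hinj _ hrel h1)).1

/-- Every shift is continuous and fixes the constant point `eqY`; only finitely many shifts occur.
-/
theorem eventually_forall_lt_shiftY {p : YPoint m → Prop}
    (h : ∀ᶠ Y in 𝓝 (eqY g x₀ u₀ φ), p Y) (s : ℕ → ℤ) (N : ℕ) :
    ∀ᶠ Y in 𝓝 (eqY g x₀ u₀ φ), ∀ k < N, p (shiftY (s k) Y) := by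
  have := (Finset.eventually_all (Finset.range N)).2 fun k _ =>
    (tendsto_shiftY (g := g) (x₀ := x₀) (u₀ := u₀) (φ := φ) (s k)).eventually h
  filter_upwards [this] with Y hY k hk using hY k (Finset.mem_range.2 hk)

end Equations

end DTFlat

/-! ### The main theorem -/

theorem mainTheorem1 {n m : ℕ}
    (f : (Fin n → ℝ) × (Fin m → ℝ) → Fin n → ℝ)
    (g : (Fin n → ℝ) × (Fin m → ℝ) → Fin m → ℝ)
    (ψ : (Fin n → ℝ) × (Fin m → ℝ) → (Fin n → ℝ) × (Fin m → ℝ))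
    (x₀ : Fin n → ℝ) (u₀ : Fin m → ℝ)
    (hf : DTFlat.IsSystem f x₀ u₀) (hg : DTFlat.IsExtension f g ψ x₀ u₀)
    {Q₁ Q₂ R₁ R₂ : Fin m → ℕ} (φ : DTFlat.OutArg n Q₁ Q₂ → Fin m → ℝ)
    (Fx : (DTFlat.Window (DTFlat.lo R₁) (DTFlat.hiPred R₂) → ℝ) → Fin n → ℝ)
    (Fu : (DTFlat.Window (DTFlat.lo R₁) (DTFlat.hi R₂) → ℝ) → Fin m → ℝ)
    (hflat : DTFlat.IsFlatOutput f g ψ x₀ u₀ φ Fx Fu) :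
    ∃ M₁ M₂ : Fin m → ℕ,
      IsLeast (DTFlat.spanOrders g Fx Fu (DTFlat.eqY g x₀ u₀ φ)) (M₁, M₂) ∧
      ((∀ᶠ Y in 𝓝 (DTFlat.eqY g x₀ u₀ φ), (DTFlat.topBlock Fu Y).rank = m) ↔ M₂ = 0) ∧
      ((∀ᶠ Y in 𝓝 (DTFlat.eqY g x₀ u₀ φ), (DTFlat.bottomBlock Fx Y).rank = m) ↔ M₁ = 0) := by
  obtain ⟨⟨M₁, M₂⟩, hM⟩ := DTFlat.exists_isLeast_spanOrders hf hg hflat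
  have hmem : ∀ᶠ Y in 𝓝 (DTFlat.eqY g x₀ u₀ φ),
      DTFlat.outputSpan R₁ R₂ Y ≤ DTFlat.systemSpan g Fx Fu M₁ M₂ Y := hM.1
  have hrel := DTFlat.eventually_lowest_relations hf hg hflat
  refine ⟨M₁, M₂, hM, ⟨fun h => ?_, ?_⟩, ⟨fun h => ?_, ?_⟩⟩
  · have h0 : (M₁, 0) ∈ DTFlat.spanOrders g Fx Fu (DTFlat.eqY g x₀ u₀ φ) := by
      filter_upwards [hmem, DTFlat.eventually_forall_lt_shiftY h (fun k => ((k + 1 : ℕ) : ℤ))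
        (∑ j, M₂ j)] with Y h1 h2
      exact DTFlat.le_systemSpan_of_topBlock_rank h2 h1
    exact le_antisymm (hM.2 h0).2 (Pi.le_def.2 fun _ => Nat.zero_le _)
  · rintro rfl
    filter_upwards [hmem] with Y hY using DTFlat.topBlock_rank_of_le hY
  · have h0 : (0, M₂) ∈ DTFlat.spanOrders g Fx Fu (DTFlat.eqY g x₀ u₀ φ) := by
      filter_upwards [hmem, DTFlat.eventually_forall_lt_shiftY (h.and hrel)
        (fun k => -((k + 1 : ℕ) : ℤ)) (∑ j, M₁ j)] with Y h1 h2
      refine DTFlat.le_systemSpan_of_zeta_injective (fun k hk v hv => ?_) h1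
      obtain ⟨h3, h4⟩ := h2 k hk
      -- A kernel vector of the block of g(F_x,F_u) is a kernel vector of the bottom block, hence
      -- zero.
      exact (DTFlat.rank_eq_iff_mulVec_injective _).1 h3 v ((h4 v).2 hv)
    exact le_antisymm (hM.2 h0).1 (Pi.le_def.2 fun _ => Nat.zero_le _)
  · rintro rfl
    filter_upwards [hmem, hrel] with Y h1 h2
    exact DTFlat.bottomBlock_rank_of_le (fun v => (h2 v).1) h1
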